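/- Let $Y=[-\tfrac12,\tfrac12]$, let $\mathbb N=\{1,2,\dots\}$, and let $\mathcal F$ be the set of finitely supported multi-indices $\nu=(\nu_1,\nu_2,\dots)$ of nonnegative integers, with $|\nu|=\sum_j\nu_j$ and $\beta^\nu=\prod_j\beta_j^{\nu_j}$. Let $\delta\ge 1$, $0<p\le 1/\delta$, $C_F>0$, and let $\beta=(\beta_j)_{j\ge1}$ be a sequence of positive reals with $\|\beta\|_{\ell^p}=\big(\sum_{j\ge1}\beta_j^p\big)^{1/p}<\infty$; if $p=1/\delta$, assume in addition that $\|\beta\|_{\ell^p}<\sqrt6$. Let $$\vartheta=\omega\ \text{ with an arbitrary } \omega\in(\tfrac12,1)\ \text{ if } p\le\tfrac{2}{3\delta},\qquad \vartheta=\frac{\delta p}{2-\delta p}\ \text{ if } \tfrac{2}{3\delta}<p\le\tfrac1\delta ,$$ and for finite $\mathfrak u\subset\mathbb N$ define the weights $$\gamma_{\mathfrak u}=\Big((|\mathfrak u|!)^{\delta}\prod_{j\in\mathfrak u}\frac{\beta_j}{\sqrt{\phi(\vartheta)}}\Big)^{\frac{2}{1+\vartheta}},\qquad \phi(\vartheta)=\frac{2\,\zeta(2\vartheta)}{(2\pi^2)^{\vartheta}}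 .$$ For a continuous $F:Y^{\mathbb N}\to\mathbb R$, $s,n\in\mathbb N$, $z\in\mathbb N_0^s$ and $\Delta\in(0,1)^s$ put $$I_s(F)=\int_{Y^s}F(y_1,\dots,y_s,0,0,\dots)\,dy_1\cdots dy_s,\qquad Q^{\Delta}_{s,n}(F)=\frac1n\sum_{i=1}^nF\Big(\Big\{\frac{i z}{n}+\Delta\Big\}-\frac12\Big),$$ where $\{\cdot\}$ is the componentwise fractional part, $\tfrac12$ is subtracted in every component, and points of $Y^s$ are extended by zeros to points of $Y^{\mathbb N}$. Call $z\in\mathbb N_0^s$ a component-by-component (CBC) generating vector for $n$ and $\gamma$ if, for $d=1,\dots,s$ in turn, $z_d$ minimises $$\sum_{\emptyset\ne\mathfrak u\subseteq\{1,\dots,d\}}\gamma_{\mathfrak u}\,\frac1n\sum_{k=1}^n\ \prod_{j\in\mathfrak u}B_2\Big(\Big\{\frac{k z_j}{n}\Big\}\Big),\qquad B_2(x)=x^2-x+\tfrac16,$$ over all $z_d\in\{0,\dots,n-1\}$ coprime to $n$, the components $z_1,\dots,z_{d-1}$ being fixed. (This quantity is the squared shift-averaged worst-case error of the lattice rule in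 the unanchored Sobolev space of mixed first derivatives on $Y^d$ with weights $\gamma_{\mathfrak u}$.) Then there is a constant $C>0$, depending only on $\delta,p,\beta,\vartheta,C_F$, and in particular independent of $s$ and $n$, such that for all $s,m\in\mathbb N$ and $n=2^m$: a CBC generating vector $z$ for $n$ and $\gamma$ exists, and for every such $z$ the randomly shifted lattice rule satisfies $$\sqrt{\mathbb E_\Delta\big(|I_s(F)-Q^{\Delta}_{s,n}(F)|^2\big)}\ \le\ C^{1/2}\Big(\frac n2\Big)^{-\frac1{2\vartheta}},\qquad \Delta\ \text{uniformly distributed over }(0,1)^s,$$ for every $F:Y^{\mathbb N}\to\mathbb R$ all of whose iterated partial derivatives exist (one-sided at end points of $Y$) and are continuous on $Y^{\mathbb N}$ with the product topology, and which satisfies $$|\partial^{\nu}F(\xi)|\le C_F\,\beta^{\nu}\,(|\nu|!)^{\delta}\qquad\text{for all }\xi\in Y^{\mathbb N},\ \nu\in\mathcal F .$$ -/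

import Mathlib

open MeasureTheory

noncomputable section

namespace GevreyQMC

/-- The parameter interval `Y = [-1/2, 1/2]`. -/
def Y : Set ℝ := Set.Icc (-(1 / 2)) (1 / 2)

/-- The infinite cube `Y^ℕ` (product topology); coordinates are indexed from `0`. -/
def cube : Set (ℕ → ℝ) := {y | ∀ j, y j ∈ Y}

/-- The partial derivative in the `j`-th coordinate of a function on `Y^ℕ`, one-sided at the end
points of `Y`. For `y ∈ cube` only the values of `G` on `cube` matter. -/
def pderiv (j : ℕ) (G : (ℕ → ℝ) → ℝ) : (ℕ → ℝ) → ℝ :=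
  fun y => derivWithin (fun t => G (Function.update y j t)) Y (y j)

/-- The iterated partial derivative `∂_{j₁} (∂_{j₂} (⋯ (∂_{jₖ} F)))` for a list `[j₁, …, jₖ]`. -/
def iterPartial (l : List ℕ) (F : (ℕ → ℝ) → ℝ) : (ℕ → ℝ) → ℝ :=
  l.foldr pderiv F

/-- The derivative `∂^ν F = ∂^{|ν|} F / (∂y₀^{ν₀} ∂y₁^{ν₁} ⋯)` for a finitely supported
multi-index `ν`. -/
def multiPartial (ν : ℕ →₀ ℕ) (F : (ℕ → ℝ) → ℝ) : (ℕ → ℝ) → ℝ :=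
  iterPartial ((Finsupp.toMultiset ν).sort (· ≤ ·)) F

/-- `F` is a smooth function on `Y^ℕ`: all iterated partial derivatives exist and are continuous
on `Y^ℕ`. -/
def SmoothOnCube (F : (ℕ → ℝ) → ℝ) : Prop :=
  ∀ l : List ℕ,
    ContinuousOn (iterPartial l F) cube ∧
    ∀ j : ℕ, ∀ y ∈ cube,
      DifferentiableWithinAt ℝ (fun t => iterPartial l F (Function.update y j t)) Y (y j)

/-- The derivative bounds `|∂^ν F(ξ)| ≤ C_F β^ν (|ν|!)^δ` for all `ξ ∈ Y^ℕ` and all finitely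
supported `ν`. -/
def GevreyBound (δ CF : ℝ) (β : ℕ → ℝ) (F : (ℕ → ℝ) → ℝ) : Prop :=
  ∀ ξ ∈ cube, ∀ ν : ℕ →₀ ℕ,
    |multiPartial ν F ξ| ≤
      CF * (ν.prod fun j k => β j ^ k) * ((Nat.factorial (ν.sum fun _ k => k) : ℕ) : ℝ) ^ δ

/-- The point `(y₁, …, y_s, 0, 0, …)`. -/
def extendZero (s : ℕ) (y : Fin s → ℝ) : ℕ → ℝ :=
  fun j => if h : j < s then y ⟨j, h⟩ else 0

/-- The truncated integral `I_s(F) = ∫_{Y^s} F(y₁, …, y_s, 0, 0, …) dy₁ ⋯ dy_s`. -/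
def truncIntegral (s : ℕ) (F : (ℕ → ℝ) → ℝ) : ℝ :=
  ∫ y in Set.univ.pi (fun _ : Fin s => Y), F (extendZero s y)

/-- The shifted lattice rule `(1/n) ∑_{i=1}^n F({i z / n + Δ} - 1/2)` in dimension `s`, whose
generating vector consists of the first `s` entries of `z`. -/
def latticeRule (s n : ℕ) (z : ℕ → ℕ) (F : (ℕ → ℝ) → ℝ) (Δ : Fin s → ℝ) : ℝ :=
  (1 / (n : ℝ)) * ∑ i ∈ Finset.Icc 1 n,
    F (extendZero s fun j => Int.fract ((i : ℝ) * (z j : ℝ) / (n : ℝ) + Δ j) - 1 / 2)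

/-- The root mean square error of the randomly shifted lattice rule, for a random shift uniformly
distributed over `(0,1)^s` (a set of volume one). -/
def rmse (s n : ℕ) (z : ℕ → ℕ) (F : (ℕ → ℝ) → ℝ) : ℝ :=
  Real.sqrt (∫ Δ in Set.univ.pi (fun _ : Fin s => Set.Ioo (0 : ℝ) 1),
    |truncIntegral s F - latticeRule s n z F Δ| ^ 2)

/-- `φ(ϑ) = 2 ζ(2ϑ) / (2π²)^ϑ`. -/
def phi (ϑ : ℝ) : ℝ :=
  2 * (riemannZeta ((2 * ϑ : ℝ) : ℂ)).re / (2 * Real.pi ^ 2) ^ ϑ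

/-- The product and order dependent weights
`γ_u = ((|u|!)^δ ∏_{j ∈ u} β_j / √φ(ϑ))^{2/(1+ϑ)}`. -/
def weight (δ ϑ : ℝ) (β : ℕ → ℝ) (u : Finset ℕ) : ℝ :=
  (((Nat.factorial u.card : ℕ) : ℝ) ^ δ * ∏ j ∈ u, β j / Real.sqrt (phi ϑ)) ^ (2 / (1 + ϑ))

/-- The squared shift-averaged worst-case error, in the `d`-dimensional weighted unanchored Sobolev
space of mixed first derivatives with norm
`‖f‖² = ∑_u γ_u⁻¹ ∫ (∫ ∂^{|u|}f/∂ξ_u dξ_{-u})² dξ_u`, of the `n`-point lattice rule with generating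
vector `(z₁, …, z_d)`: `∑_{∅ ≠ u ⊆ {1:d}} γ_u (1/n) ∑_{k=1}^n ∏_{j ∈ u} B₂({k z_j / n})` with the
Bernoulli polynomial `B₂(x) = x² - x + 1/6`. -/
def shiftAvgErrorSq (n : ℕ) (γ : Finset ℕ → ℝ) (d : ℕ) (z : ℕ → ℕ) : ℝ :=
  ∑ u ∈ (Finset.range d).powerset.erase ∅,
    γ u * ((1 / (n : ℝ)) * ∑ k ∈ Finset.Icc 1 n,
      ∏ j ∈ u, bernoulliFun 2 (Int.fract ((k : ℝ) * (z j : ℝ) / (n : ℝ))))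

/-- The first `s` entries of `z` are an output of the component-by-component construction for `n`
points and weights `γ`: every component is chosen among the residues coprime to `n` so as to
minimise the shift-averaged worst-case error, the previous components being kept fixed. -/
def IsCBC (n : ℕ) (γ : Finset ℕ → ℝ) (s : ℕ) (z : ℕ → ℕ) : Prop :=
  ∀ d < s, z d < n ∧ Nat.Coprime (z d) n ∧
    ∀ c < n, Nat.Coprime c n →
      shiftAvgErrorSq n γ (d + 1) z ≤ shiftAvgErrorSq n γ (d + 1) (Function.update z d c)

end GevreyQMC

end

/-! Expanding `F` one coordinate at a time by the identity `g x = ∫ (g + g' κ(x, ·))` writes `F` at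
any point as a sum over `u` of integrals of the mixed derivative `∂_u F` against a product of
kernels (`SmoothOnCube.eq_integral_mixedPartial`). Averaged over the lattice points, the term `u =
∅` is the exact integral, so the error is the sum of the other terms. The derivative bound and a
Cauchy–Schwarz inequality weighted by `γ` bound the squared error by a product of two sums.
Averaging over the shift turns the second one into `shiftAvgErrorSq`, because the averaged product
of two kernels is `B₂` of the difference of the points (`GevreyBound.rmse_sq_le`).

For the CBC vector, `B₂` has nonnegative Fourier coefficients, so each new component adds to the
error a sum of nonnegative terms. The `ϑ`-th power is subadditive, and a minimum is at most a mean
over the `n.totient` admissible residues, which gives the bound `(1/totient n) ∑ γ_u^ϑ φ(ϑ)^|u|` for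
the `ϑ`-th power of the squared error (`IsCBC.shiftAvgErrorSq_rpow_le`).

The weights make the first Cauchy–Schwarz factor equal to `C_F²` times the same sum
(`sq_div_weight`), so it remains to bound `∑ γ_u^ϑ φ(ϑ)^|u|` uniformly in `s`. With `q = 2ϑ/(1+ϑ)`
its terms are `(|u|!)^(δq) ∏ x_j`, and `x_j^(1/δ)` is summable since `p ≤ q/δ`. The sets of size `k`
contribute at most `(k!)^(-δ(1-q)) X^(δk)`, where `X = ∑ x_j^(1/δ)`. This is summable if `q < 1`; if
`q = 1` it is a geometric series, whose convergence is the condition `‖β‖ < √6`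
(`exists_bound_sum_powerset`, `exists_bound_sum_weight`). -/

namespace GevreyQMC

/-! ### Summability of the weighted terms -/

theorem rpow_sum_le_sum_rpow {ι : Type*} (s : Finset ι) {f : ι → ℝ} (hf : ∀ i ∈ s, 0 ≤ f i)
    {r : ℝ} (hr0 : 0 < r) (hr1 : r ≤ 1) : (∑ i ∈ s, f i) ^ r ≤ ∑ i ∈ s, f i ^ r := by
  classical
  induction s using Finset.induction_on with
  | empty => simp [Real.zero_rpow hr0.ne']
  | insert a s ha ih =>
    rw [Finset.sum_insert ha, Finset.sum_insert ha]
    have h1 := ih fun i hi => hf i (Finset.mem_insert_of_mem hi)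
    have h2 := Real.rpow_add_le_add_rpow (hf a (Finset.mem_insert_self _ _))
      (Finset.sum_nonneg fun i hi => hf i (Finset.mem_insert_of_mem hi)) hr0.le hr1
    linarith

theorem sum_le_rpow_sum_rpow {ι : Type*} (s : Finset ι) {f : ι → ℝ} (hf : ∀ i ∈ s, 0 ≤ f i)
    {δ : ℝ} (hδ : 1 ≤ δ) : ∑ i ∈ s, f i ≤ (∑ i ∈ s, f i ^ (1 / δ)) ^ δ := by
  have hδ0 : 0 < δ := by linarith
  have h := rpow_sum_le_sum_rpow s hf (r := 1 / δ) (by positivity)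
    (by rw [div_le_one hδ0]; exact hδ)
  have h0 := Finset.sum_nonneg hf
  calc ∑ i ∈ s, f i = ((∑ i ∈ s, f i) ^ (1 / δ)) ^ δ := by
        rw [← Real.rpow_mul h0, one_div_mul_cancel hδ0.ne', Real.rpow_one]
    _ ≤ _ := Real.rpow_le_rpow (by positivity) h hδ0.le

/-- The first two terms of the binomial expansion; the induction step of the next lemma needs no
more. -/
theorem pow_succ_add_mul_le {a b : ℝ} (ha : 0 ≤ a) (hb : 0 ≤ b) (k : ℕ) :
    a ^ (k + 1) + ((k + 1 : ℕ) : ℝ) * b * a ^ k ≤ (a + b) ^ (k + 1) := by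
  induction k with
  | zero => simp
  | succ k ih =>
    have h : (a ^ (k + 1) + ((k + 1 : ℕ) : ℝ) * b * a ^ k) * (a + b) ≤ (a + b) ^ (k + 1 + 1) := by
      rw [pow_succ (a + b)]
      exact mul_le_mul_of_nonneg_right ih (by positivity)
    refine le_trans ?_ h
    have : 0 ≤ ((k + 1 : ℕ) : ℝ) * b * a ^ k * b := by positivity
    push_cast at this ⊢
    ring_nf at this ⊢
    linarith

/-- The left side collects the squarefree monomials of the multinomial expansion of the right side.
The induction separates the sets that contain the new element from those that do not. -/
theorem factorial_mul_sum_powersetCard_prod_le {ι : Type*} (s : Finset ι) {x : ι → ℝ}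
    (hx : ∀ i, 0 ≤ x i) (k : ℕ) :
    (k.factorial : ℝ) * ∑ u ∈ s.powersetCard k, ∏ i ∈ u, x i ≤ (∑ i ∈ s, x i) ^ k := by
  classical
  induction s using Finset.induction_on generalizing k with
  | empty =>
    cases k with
    | zero => simp
    | succ k => rw [Finset.powersetCard_eq_empty.2 (by simp)]; simp
  | insert a s ha ih =>
    cases k with
    | zero => simp
    | succ k =>
      have hS : 0 ≤ ∑ i ∈ s, x i := Finset.sum_nonneg fun i _ => hx i
      rw [Finset.powersetCard_succ_insert ha, Finset.sum_union, Finset.sum_image,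
        Finset.sum_insert ha, mul_add]
      · have h1 : ∑ u ∈ s.powersetCard k, ∏ i ∈ insert a u, x i
            = x a * ∑ u ∈ s.powersetCard k, ∏ i ∈ u, x i := by
          rw [Finset.mul_sum]
          refine Finset.sum_congr rfl fun u hu => Finset.prod_insert fun h => ha ?_
          exact (Finset.mem_powersetCard.1 hu).1 h
        rw [h1]
        have h2 := ih (k + 1)
        have h3 := mul_le_mul_of_nonneg_left (ih k)
          (mul_nonneg (Nat.cast_nonneg (k + 1) : (0 : ℝ) ≤ ((k + 1 : ℕ) : ℝ)) (hx a))
        have h4 : (∑ i ∈ s, x i) ^ (k + 1) + ((k + 1 : ℕ) : ℝ) * x a * (∑ i ∈ s, x i) ^ k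
            ≤ (x a + ∑ i ∈ s, x i) ^ (k + 1) := by
          rw [add_comm (x a)]
          exact pow_succ_add_mul_le hS (hx a) k
        calc _ ≤ (∑ i ∈ s, x i) ^ (k + 1) + ((k + 1 : ℕ) : ℝ) * x a * (∑ i ∈ s, x i) ^ k := by
              refine add_le_add h2 (le_of_eq_of_le ?_ h3)
              rw [Nat.factorial_succ]; push_cast; ring
          _ ≤ _ := h4
      · intro u hu v hv huv
        have hau : a ∉ u := fun h => ha ((Finset.mem_powersetCard.1 hu).1 h)
        have hav : a ∉ v := fun h => ha ((Finset.mem_powersetCard.1 hv).1 h)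
        rw [← Finset.erase_insert hau, ← Finset.erase_insert hav]
        exact congrArg (fun w => w.erase a) huv
      · rw [Finset.disjoint_left]
        intro u hu hu'
        obtain ⟨v, -, rfl⟩ := Finset.mem_image.1 hu'
        exact ha ((Finset.mem_powersetCard.1 hu).1 (Finset.mem_insert_self _ _))

theorem summable_factorial_rpow_neg_mul_pow {ε Z : ℝ} (hε : 0 < ε) (hZ : 0 ≤ Z) :
    Summable fun k : ℕ => (k.factorial : ℝ) ^ (-ε) * Z ^ k := by
  rcases hZ.eq_or_lt with rfl | hZ
  · refine summable_of_ne_finset_zero (s := {0}) fun k hk => ?_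
    rw [zero_pow (by simpa using hk), mul_zero]
  refine summable_of_ratio_test_tendsto_lt_one (l := 0) one_pos
    (Filter.Eventually.of_forall fun k => by positivity) ?_
  have h : (fun k : ℕ => ‖((k + 1).factorial : ℝ) ^ (-ε) * Z ^ (k + 1)‖ /
      ‖(k.factorial : ℝ) ^ (-ε) * Z ^ k‖) = fun k : ℕ => ((k + 1 : ℕ) : ℝ) ^ (-ε) * Z := by
    funext k
    rw [Real.norm_of_nonneg (by positivity), Real.norm_of_nonneg (by positivity),
      Nat.factorial_succ, Nat.cast_mul, Real.mul_rpow (by positivity) (by positivity)]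
    have : (k.factorial : ℝ) ^ (-ε) ≠ 0 := by positivity
    field_simp
    rw [pow_succ]
  rw [h]
  have := ((tendsto_rpow_neg_atTop hε).comp
    (tendsto_natCast_atTop_atTop.comp (Filter.tendsto_add_atTop_nat 1))).mul_const Z
  simpa [Function.comp_def] using this

/-- Group the sets by cardinality `k`. Passing from the `ℓ¹` to the `ℓ^(1/δ)` quasi-norm before
using the multinomial bound gains `(k!)^(-δ)`, which beats `(k!)^(δq)` when `q < 1` and exactly
cancels it when `q = 1`. -/
theorem exists_bound_sum_powerset {δ q : ℝ} (hδ : 1 ≤ δ) (hq1 : q ≤ 1)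
    {x : ℕ → ℝ} (hx : ∀ j, 0 ≤ x j) (hs : Summable fun j => x j ^ (1 / δ))
    (hcrit : q = 1 → (∑' j, x j ^ (1 / δ)) ^ δ < 1) :
    ∃ S : ℝ, 0 < S ∧ ∀ s : ℕ, ∑ u ∈ (Finset.range s).powerset,
      (u.card.factorial : ℝ) ^ (δ * q) * ∏ j ∈ u, x j ≤ S := by
  have hδ0 : 0 < δ := by linarith
  set X := ∑' j, x j ^ (1 / δ) with hX
  have hX0 : 0 ≤ X := tsum_nonneg fun j => Real.rpow_nonneg (hx j) _
  have hsum : Summable fun k : ℕ => (k.factorial : ℝ) ^ (-(δ * (1 - q))) * (X ^ δ) ^ k := by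
    rcases hq1.eq_or_lt with h | h
    · simpa [h] using summable_geometric_of_lt_one (by positivity) (hcrit h)
    · exact summable_factorial_rpow_neg_mul_pow (mul_pos hδ0 (by linarith)) (by positivity)
  have hterm : ∀ s k : ℕ, ∑ u ∈ (Finset.range s).powersetCard k,
      (u.card.factorial : ℝ) ^ (δ * q) * ∏ j ∈ u, x j
      ≤ (k.factorial : ℝ) ^ (-(δ * (1 - q))) * (X ^ δ) ^ k := by
    intro s k
    have hk : (0 : ℝ) < k.factorial := by positivity
    have h1 : ∑ u ∈ (Finset.range s).powersetCard k, (u.card.factorial : ℝ) ^ (δ * q) *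
        ∏ j ∈ u, x j = (k.factorial : ℝ) ^ (δ * q) *
        ∑ u ∈ (Finset.range s).powersetCard k, ∏ j ∈ u, x j := by
      rw [Finset.mul_sum]
      exact Finset.sum_congr rfl fun u hu => by rw [(Finset.mem_powersetCard.1 hu).2]
    have h2 := sum_le_rpow_sum_rpow ((Finset.range s).powersetCard k)
      (f := fun u => ∏ j ∈ u, x j) (fun u _ => Finset.prod_nonneg fun j _ => hx j) hδ
    have h3 := factorial_mul_sum_powersetCard_prod_le (Finset.range s)
      (x := fun j => x j ^ (1 / δ)) (fun j => Real.rpow_nonneg (hx j) _) k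
    have h4 : ∑ j ∈ Finset.range s, x j ^ (1 / δ) ≤ X :=
      hs.sum_le_tsum _ fun j _ => Real.rpow_nonneg (hx j) _
    have h5 : ∑ u ∈ (Finset.range s).powersetCard k, (∏ j ∈ u, x j) ^ (1 / δ)
        ≤ X ^ k / k.factorial := by
      rw [le_div_iff₀ hk, mul_comm]
      simp_rw [← Real.finsetProd_rpow _ _ fun i _ => hx i]
      exact h3.trans (pow_le_pow_left₀
        (Finset.sum_nonneg fun j _ => Real.rpow_nonneg (hx j) _) h4 k)
    rw [h1]
    calc _ ≤ (k.factorial : ℝ) ^ (δ * q) * (X ^ k / k.factorial) ^ δ := by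
          refine mul_le_mul_of_nonneg_left (h2.trans (Real.rpow_le_rpow ?_ h5 hδ0.le))
            (by positivity)
          exact Finset.sum_nonneg fun u _ =>
            Real.rpow_nonneg (Finset.prod_nonneg fun j _ => hx j) _
      _ = _ := by
          rw [Real.div_rpow (by positivity) hk.le, ← Real.rpow_natCast (X ^ δ),
            ← Real.rpow_mul hX0, mul_comm δ (k : ℝ), Real.rpow_mul hX0, Real.rpow_natCast,
            show -(δ * (1 - q)) = δ * q - δ by ring, Real.rpow_sub hk]
          ring
  refine ⟨∑' k : ℕ, (k.factorial : ℝ) ^ (-(δ * (1 - q))) * (X ^ δ) ^ k, ?_, fun s => ?_⟩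
  · refine hsum.tsum_pos (fun k => by positivity) 0 (by simp)
  · rw [Finset.sum_powerset]
    exact (Finset.sum_le_sum fun k _ => hterm s k).trans
      (hsum.sum_le_tsum _ fun k _ => by positivity)

/-! ### Fourier coefficients of the Bernoulli polynomial on residue classes -/

/-- The `ϑ`-th power of the `h`-th Fourier coefficient of the Bernoulli polynomial `B₂`. -/
noncomputable def bernoulliCoeffPow (ϑ : ℝ) (h : ℤ) : ℝ := (1 / (2 * Real.pi ^ 2 * (h : ℝ) ^ 2)) ^ ϑ

theorem bernoulliCoeffPow_nonneg (ϑ : ℝ) (h : ℤ) : 0 ≤ bernoulliCoeffPow ϑ h := by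
  unfold bernoulliCoeffPow; positivity

/-- The convention `1 / 0 = 0` yields the correct coefficient here: `B₂` has mean zero. -/
theorem bernoulliCoeffPow_zero {ϑ : ℝ} (hϑ : 1 / 2 < ϑ) : bernoulliCoeffPow ϑ 0 = 0 := by
  simp [bernoulliCoeffPow, Real.zero_rpow (show ϑ ≠ 0 by linarith)]

theorem bernoulliCoeffPow_eq {ϑ : ℝ} (h : ℤ) :
    bernoulliCoeffPow ϑ h = (1 / (2 * Real.pi ^ 2) ^ ϑ) * (1 / |(h : ℝ)| ^ (2 * ϑ)) := by
  rw [bernoulliCoeffPow, ← sq_abs (h : ℝ), Real.div_rpow (by positivity) (by positivity),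
    Real.mul_rpow (by positivity) (by positivity), Real.one_rpow, Real.rpow_mul (abs_nonneg _)]
  norm_cast
  field_simp

theorem bernoulliCoeffPow_neg {ϑ : ℝ} (h : ℤ) :
    bernoulliCoeffPow ϑ (-h) = bernoulliCoeffPow ϑ h := by
  simp [bernoulliCoeffPow]

theorem hasSum_bernoulliCoeffPow {ϑ : ℝ} (hϑ : 1 / 2 < ϑ) :
    HasSum (bernoulliCoeffPow ϑ) (phi ϑ) := by
  have h1 : Summable fun k : ℕ => 1 / (k : ℝ) ^ (2 * ϑ) :=
    Real.summable_one_div_nat_rpow.2 (by linarith)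
  have hz : riemannZeta ((2 * ϑ : ℝ) : ℂ) = ((∑' k : ℕ, 1 / (k : ℝ) ^ (2 * ϑ) : ℝ) : ℂ) := by
    rw [zeta_eq_tsum_one_div_nat_cpow (by rw [Complex.ofReal_re]; linarith), Complex.ofReal_tsum]
    refine tsum_congr fun k => ?_
    rw [← Complex.ofReal_natCast, ← Complex.ofReal_cpow (Nat.cast_nonneg k)]
    push_cast; rfl
  have h2 : HasSum (fun k : ℕ => bernoulliCoeffPow ϑ k)
      ((1 / (2 * Real.pi ^ 2) ^ ϑ) * ∑' k : ℕ, 1 / (k : ℝ) ^ (2 * ϑ)) := by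
    have := h1.hasSum.mul_left (1 / (2 * Real.pi ^ 2) ^ ϑ)
    simpa only [bernoulliCoeffPow_eq, Int.cast_natCast, Nat.abs_cast] using this
  -- The two half-line sums both contain `h = 0`, hence the subtracted value at `0`; their equality
  -- is the factor `2` in `φ`.
  have h3 := HasSum.of_nat_of_neg h2 (by simpa only [bernoulliCoeffPow_neg] using h2)
  rw [bernoulliCoeffPow_zero hϑ, sub_zero] at h3
  convert! h3 using 1
  rw [phi, hz, Complex.ofReal_re]
  ring

theorem phi_pos {ϑ : ℝ} (hϑ : 1 / 2 < ϑ) : 0 < phi ϑ := by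
  rw [← (hasSum_bernoulliCoeffPow hϑ).tsum_eq]
  refine (hasSum_bernoulliCoeffPow hϑ).summable.tsum_pos (bernoulliCoeffPow_nonneg ϑ) 1 ?_
  unfold bernoulliCoeffPow
  push_cast
  positivity

/-- The source of the threshold `√6` in the critical case. -/
theorem phi_one : phi 1 = 1 / 6 := by
  have h : riemannZeta ((2 * 1 : ℝ) : ℂ) = ((Real.pi ^ 2 / 6 : ℝ) : ℂ) := by
    push_cast
    rw [mul_one, riemannZeta_two]
  rw [phi, h, Complex.ofReal_re, Real.rpow_one]
  have := Real.pi_pos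
  field_simp

/-- The sum of the `ϑ`-th powers of the Fourier coefficients of `B₂` over a residue class. -/
noncomputable def residueCoeff (n : ℕ) (ϑ : ℝ) (r : ZMod n) : ℝ :=
  ∑' h : ℤ, if (h : ZMod n) = r then bernoulliCoeffPow ϑ h else 0

variable {n : ℕ} {ϑ : ℝ}

theorem residueCoeff_nonneg (r : ZMod n) : 0 ≤ residueCoeff n ϑ r :=
  tsum_nonneg fun h => by split_ifs <;> simp [bernoulliCoeffPow_nonneg]

theorem summable_residueCoeff (hϑ : 1 / 2 < ϑ) (r : ZMod n) :
    Summable fun h : ℤ => if (h : ZMod n) = r then bernoulliCoeffPow ϑ h else 0 :=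
  Summable.of_nonneg_of_le (fun h => by split_ifs <;> simp [bernoulliCoeffPow_nonneg])
    (fun h => by split_ifs <;> simp [bernoulliCoeffPow_nonneg])
    (hasSum_bernoulliCoeffPow hϑ).summable

theorem residueCoeff_one_rpow_le (h0 : 1 / 2 < ϑ) (h1 : ϑ ≤ 1) (r : ZMod n) :
    residueCoeff n 1 r ^ ϑ ≤ residueCoeff n ϑ r := by
  have hϑ : 0 < ϑ := by linarith
  have h : residueCoeff n 1 r ≤ residueCoeff n ϑ r ^ (1 / ϑ) := by
    refine (summable_residueCoeff (by norm_num) r).tsum_le_of_sum_le fun t => ?_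
    rw [one_div ϑ, Real.le_rpow_inv_iff_of_pos ?_ (residueCoeff_nonneg r) hϑ]
    · refine (rpow_sum_le_sum_rpow t ?_ hϑ h1).trans
        (le_trans (Finset.sum_le_sum fun h _ => ?_)
          ((summable_residueCoeff h0 r).sum_le_tsum t ?_))
      · intro h _; split_ifs <;> simp [bernoulliCoeffPow_nonneg]
      · split_ifs
        · simp [bernoulliCoeffPow]
        · simp [Real.zero_rpow hϑ.ne']
      · intro h _; split_ifs <;> simp [bernoulliCoeffPow_nonneg]
    · exact Finset.sum_nonneg fun h _ => by split_ifs <;> simp [bernoulliCoeffPow_nonneg]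
  calc residueCoeff n 1 r ^ ϑ ≤ (residueCoeff n ϑ r ^ (1 / ϑ)) ^ ϑ :=
        Real.rpow_le_rpow (residueCoeff_nonneg r) h hϑ.le
    _ = _ := by rw [← Real.rpow_mul (residueCoeff_nonneg r), one_div_mul_cancel hϑ.ne',
        Real.rpow_one]

/-- A nonempty solution set is a translate of a subset of the kernel of multiplication by `a`. By
Bézout the gcd annihilates that kernel, and a cyclic group has at most `g` elements killed by `g`.
-/
theorem card_mul_eq_le [NeZero n] (a b : ZMod n) :
    (Finset.univ.filter fun c : ZMod n => a * c = b).card ≤ Nat.gcd a.val n := by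
  classical
  rcases (Finset.univ.filter fun c : ZMod n => a * c = b).eq_empty_or_nonempty with h | ⟨c₀, hc₀⟩
  · simp [h]
  have hg : 0 < Nat.gcd a.val n := Nat.gcd_pos_of_pos_right _ (NeZero.pos n)
  refine le_trans ?_ (IsAddCyclic.card_nsmul_eq_zero_le (α := ZMod n) hg)
  refine Finset.card_le_card_of_injOn (fun c => c - c₀) (fun c hc => ?_)
    (fun c _ d _ h => sub_left_injective h)
  simp only [Finset.coe_filter, Finset.mem_univ, true_and, Set.mem_ofPred_eq,
    Finset.mem_filter] at hc hc₀ ⊢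
  have h0 : a * (c - c₀) = 0 := by rw [mul_sub, hc, hc₀, sub_self]
  have h1 := congrArg (fun t : ℤ => (t : ZMod n)) (Nat.gcd_eq_gcd_ab a.val n)
  push_cast at h1
  rw [nsmul_eq_mul, h1, ZMod.natCast_self, zero_mul, add_zero, ZMod.natCast_zmod_val, mul_right_comm, h0,
    zero_mul]

theorem gcd_val_dvd_of_mul_eq [NeZero n] {a c : ZMod n} {h : ℤ} (hc : a * c = h) :
    ((Nat.gcd a.val n : ℕ) : ℤ) ∣ h := by
  have h1 : ((a.val * c.val - h : ℤ) : ZMod n) = 0 := by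
    push_cast
    rw [ZMod.natCast_zmod_val, ZMod.natCast_zmod_val, hc, sub_self]
  have h2 : (n : ℤ) ∣ a.val * c.val - h := (ZMod.intCast_zmod_eq_zero_iff_dvd _ n).1 h1
  have h3 : ((Nat.gcd a.val n : ℕ) : ℤ) ∣ a.val * c.val - h :=
    (Int.natCast_dvd_natCast.2 (Nat.gcd_dvd_right _ _)).trans h2
  have h4 : ((Nat.gcd a.val n : ℕ) : ℤ) ∣ a.val * c.val :=
    (Int.natCast_dvd_natCast.2 (Nat.gcd_dvd_left _ _)).mul_right _
  exact (dvd_sub_right h4).1 h3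

/-- Since `2ϑ > 1`, the decay `g^(-2ϑ)` outweighs the multiplicity `g`. -/
theorem natCast_mul_bernoulliCoeffPow_mul_le (h0 : 1 / 2 < ϑ) {g : ℕ} (hg : 0 < g) (h : ℤ) :
    (g : ℝ) * bernoulliCoeffPow ϑ (g * h) ≤ bernoulliCoeffPow ϑ h := by
  have hg1 : (1 : ℝ) ≤ g := by exact_mod_cast hg
  rw [bernoulliCoeffPow_eq, bernoulliCoeffPow_eq]
  push_cast
  rw [abs_mul, Real.mul_rpow (abs_nonneg _) (abs_nonneg _), Nat.abs_cast]
  have hgp : (g : ℝ) ≤ (g : ℝ) ^ (2 * ϑ) := by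
    conv_lhs => rw [← Real.rpow_one (g : ℝ)]
    exact Real.rpow_le_rpow_of_exponent_le hg1 (by linarith)
  have hgg : (g : ℝ) * (1 / (g : ℝ) ^ (2 * ϑ)) ≤ 1 := by
    rw [mul_one_div, div_le_one (by positivity)]; exact hgp
  calc _ = ((g : ℝ) * (1 / (g : ℝ) ^ (2 * ϑ))) *
        ((1 / (2 * Real.pi ^ 2) ^ ϑ) * (1 / |(h : ℝ)| ^ (2 * ϑ))) := by
          rw [one_div_mul_eq_div, one_div_mul_eq_div, div_div, ← one_div_mul_one_div,
            one_div_mul_eq_div]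
          ring
    _ ≤ _ := mul_le_of_le_one_left (by positivity) hgg

/-- With `g = gcd(a, n)`, a frequency `h` is reached by at most `g` residues `c`, and by none unless
`g ∣ h`. The sum is thus at most `∑ g r(gh)` for the `ϑ`-th powers `r` of the coefficients, and the
decay of `r` absorbs `g`. The bound is uniform in `a`, zero divisors included, so `n` need not be
prime. -/
theorem sum_residueCoeff_mul_rpow_le [NeZero n] (h0 : 1 / 2 < ϑ) (h1 : ϑ ≤ 1) (a : ZMod n) :
    ∑ c : ZMod n, residueCoeff n 1 (a * c) ^ ϑ ≤ phi ϑ := by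
  classical
  have hS := (hasSum_bernoulliCoeffPow h0).summable
  set g := Nat.gcd a.val n with hgdef
  have hg : 0 < g := Nat.gcd_pos_of_pos_right _ (NeZero.pos n)
  have hgz : (g : ℤ) ≠ 0 := by exact_mod_cast hg.ne'
  have hinj : Function.Injective fun h : ℤ => (g : ℤ) * h := mul_right_injective₀ hgz
  set F : ℤ → ℝ := fun h => if (g : ℤ) ∣ h then (g : ℝ) * bernoulliCoeffPow ϑ h else 0 with hF
  have hFsupp : Function.support F ⊆ Set.range fun h : ℤ => (g : ℤ) * h := by
    intro h hh
    by_cases hd : (g : ℤ) ∣ h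
    · obtain ⟨k, rfl⟩ := hd; exact ⟨k, rfl⟩
    · simp [hF, hd] at hh
  have hFsum : Summable F :=
    Summable.of_nonneg_of_le
      (fun h => by
        simp only [hF]
        split_ifs
        · exact mul_nonneg (Nat.cast_nonneg _) (bernoulliCoeffPow_nonneg ϑ h)
        · exact le_rfl)
      (fun h => by
        simp only [hF]
        split_ifs
        · exact le_rfl
        · exact mul_nonneg (Nat.cast_nonneg _) (bernoulliCoeffPow_nonneg ϑ h))
      (hS.mul_left (g : ℝ))
  calc ∑ c : ZMod n, residueCoeff n 1 (a * c) ^ ϑ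
      ≤ ∑ c : ZMod n, residueCoeff n ϑ (a * c) :=
        Finset.sum_le_sum fun c _ => residueCoeff_one_rpow_le h0 h1 _
    _ = ∑' h : ℤ, ∑ c : ZMod n, if (h : ZMod n) = a * c then bernoulliCoeffPow ϑ h else 0 :=
        (Summable.tsum_finsetSum fun c _ => summable_residueCoeff h0 _).symm
    _ ≤ ∑' h : ℤ, F h := by
        refine Summable.tsum_le_tsum (fun h => ?_)
          (summable_sum fun c _ => summable_residueCoeff h0 _) hFsum
        rw [← Finset.sum_filter, Finset.sum_const, nsmul_eq_mul]
        simp only [hF]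
        split_ifs with hd
        · refine mul_le_mul_of_nonneg_right ?_ (bernoulliCoeffPow_nonneg ϑ h)
          have := card_mul_eq_le a (h : ZMod n)
          simp only [eq_comm] at this ⊢
          exact_mod_cast this
        · rw [Finset.filter_false_of_mem, Finset.card_empty, Nat.cast_zero, zero_mul]
          exact fun c _ hc => hd (gcd_val_dvd_of_mul_eq hc.symm)
    _ = ∑' h : ℤ, F (g * h) := (hinj.tsum_eq hFsupp).symm
    _ ≤ ∑' h : ℤ, bernoulliCoeffPow ϑ h := by
        refine Summable.tsum_le_tsum (fun h => ?_) (hFsum.comp_injective hinj) hS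
        simp only [hF, dvd_mul_right, if_true]
        exact natCast_mul_bernoulliCoeffPow_mul_le h0 hg h
    _ = phi ϑ := (hasSum_bernoulliCoeffPow h0).tsum_eq

/-- The values of `B₂` at the multiples of `1 / n`, as a function on residue classes. -/
noncomputable def bernoulliZMod (n : ℕ) (x : ZMod n) : ℝ := bernoulliFun 2 ((x.val : ℝ) / n)

/-- Aliasing: at multiples of `1 / n` the Fourier modes of `B₂` depend only on `h` modulo `n`, so
the absolutely convergent series can be grouped by residue class. -/
theorem bernoulliZMod_eq_sum [NeZero n] (x : ZMod n) :
    (bernoulliZMod n x : ℂ) =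
      ∑ r : ZMod n, (residueCoeff n 1 r : ℂ) * ZMod.stdAddChar (r * x) := by
  have hn : (0 : ℝ) < n := by exact_mod_cast NeZero.pos n
  have hx : (x.val : ℝ) / n ∈ Set.Icc (0 : ℝ) 1 :=
    ⟨by positivity, by rw [div_le_one hn]; exact_mod_cast (ZMod.val_lt x).le⟩
  have hpi : (Real.pi : ℂ) ≠ 0 := by exact_mod_cast Real.pi_ne_zero
  have h1 := (hasSum_one_div_pow_mul_fourier_mul_bernoulliFun (k := 2) le_rfl hx).mul_left
    (1 / (2 * (Real.pi : ℂ) ^ 2))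
  have h2 : HasSum (fun h : ℤ => (bernoulliCoeffPow 1 h : ℂ) * ZMod.stdAddChar ((h : ZMod n) * x))
      (bernoulliZMod n x : ℂ) := by
    convert! h1 using 1
    · funext h
      have h3 : ZMod.stdAddChar ((h : ZMod n) * x)
          = fourier h (((x.val : ℝ) / n : ℝ) : UnitAddCircle) := by
        have : (h : ZMod n) * x = ((h * x.val : ℤ) : ZMod n) := by
          push_cast; rw [ZMod.natCast_zmod_val]
        rw [this, ZMod.stdAddChar_coe, fourier_coe_apply]
        congr 1
        push_cast
        field_simp
      rw [h3, bernoulliCoeffPow, Real.rpow_one]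
      push_cast
      rw [← mul_assoc]
      congr 1
      rw [one_div_mul_one_div]
    · rw [bernoulliZMod, mul_pow, mul_pow, Complex.I_sq]
      generalize bernoulliFun 2 ((x.val : ℝ) / n) = B
      simp only [Nat.factorial_two, Nat.cast_ofNat]
      field_simp
  have h4 : ∀ r : ZMod n, HasSum (fun h : ℤ => if (h : ZMod n) = r then
      (bernoulliCoeffPow 1 h : ℂ) * ZMod.stdAddChar ((h : ZMod n) * x) else 0)
      ((residueCoeff n 1 r : ℂ) * ZMod.stdAddChar (r * x)) := by
    intro r
    have h5 := Complex.hasSum_ofReal.2 (summable_residueCoeff (n := n) (ϑ := 1) (by norm_num) r).hasSum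
    have h6 := h5.mul_right ((ZMod.stdAddChar (r * x) : ℂ))
    convert! h6 using 1
    funext h
    split_ifs with hr
    · rw [hr]
    · simp
  refine h2.unique ?_
  have h7 := hasSum_sum (s := Finset.univ) fun r _ => h4 r
  convert! h7 using 1
  funext h
  simp

/-! ### The component-by-component error bound -/

/-- A product of values of `B₂` is the discrete Fourier transform of a nonnegative function with
controlled `ℓ^ϑ` quasi-norm. -/
theorem exists_transform_prod_bernoulliZMod [NeZero n] (h0 : 1 / 2 < ϑ) (h1 : ϑ ≤ 1) (z : ℕ → ℕ)
    (u : Finset ℕ) :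
    ∃ V : ZMod n → ℝ, (∀ a, 0 ≤ V a) ∧ ∑ a, V a ^ ϑ ≤ phi ϑ ^ u.card ∧
      ∀ k : ZMod n, ((∏ j ∈ u, bernoulliZMod n (k * z j) : ℝ) : ℂ) =
        ∑ a, (V a : ℂ) * ZMod.stdAddChar (a * k) := by
  classical
  have hϑ : 0 < ϑ := by linarith
  induction u using Finset.induction_on with
  | empty =>
    -- The empty product is the constant `1`, whose transform is the unit mass at frequency `0`.
    refine ⟨Pi.single 0 1, fun a => ?_, ?_, fun k => ?_⟩
    · by_cases h : a = 0
      · simp [h]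
      · simp [Pi.single_eq_of_ne h]
    · rw [Finset.sum_eq_single 0]
      · simp
      · intro a _ ha; rw [Pi.single_eq_of_ne ha, Real.zero_rpow hϑ.ne']
      · simp
    · rw [Finset.sum_eq_single 0]
      · simp
      · intro a _ ha; rw [Pi.single_eq_of_ne ha]; simp
      · simp
  | insert j u hj ih =>
    obtain ⟨V, hV, hVs, hVt⟩ := ih
    -- Multiplication by `B₂(k z_j / n)` becomes a convolution along the multiples of `z_j`.
    -- Subadditivity of the `ϑ`-th power makes the quasi-norms multiply.
    refine ⟨fun a => ∑ r, residueCoeff n 1 r * V (a - r * z j), fun a =>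
      Finset.sum_nonneg fun r _ => mul_nonneg (residueCoeff_nonneg r) (hV _), ?_, fun k => ?_⟩
    · calc ∑ a, (∑ r, residueCoeff n 1 r * V (a - r * z j)) ^ ϑ
          ≤ ∑ a, ∑ r, (residueCoeff n 1 r * V (a - r * z j)) ^ ϑ :=
            Finset.sum_le_sum fun a _ => rpow_sum_le_sum_rpow _
              (fun r _ => mul_nonneg (residueCoeff_nonneg r) (hV _)) hϑ h1
        _ = ∑ r, residueCoeff n 1 r ^ ϑ * ∑ a, V a ^ ϑ := by
            rw [Finset.sum_comm]
            refine Finset.sum_congr rfl fun r _ => ?_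
            rw [Finset.mul_sum, ← Equiv.sum_comp (Equiv.subRight (r * (z j : ZMod n)))
              (fun a => residueCoeff n 1 r ^ ϑ * V a ^ ϑ)]
            exact Finset.sum_congr rfl fun a _ =>
              Real.mul_rpow (residueCoeff_nonneg r) (hV _)
        _ = (∑ r, residueCoeff n 1 r ^ ϑ) * ∑ a, V a ^ ϑ := by rw [Finset.sum_mul]
        _ ≤ phi ϑ * phi ϑ ^ u.card := by
            refine mul_le_mul ?_ hVs (Finset.sum_nonneg fun a _ => Real.rpow_nonneg (hV a) _)
              (phi_pos h0).le
            simpa using sum_residueCoeff_mul_rpow_le (n := n) h0 h1 1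
        _ = _ := by rw [Finset.card_insert_of_notMem hj, pow_succ']
    · rw [Finset.prod_insert hj, Complex.ofReal_mul, hVt k, bernoulliZMod_eq_sum, Finset.sum_mul]
      simp_rw [Complex.ofReal_sum, Finset.sum_mul]
      rw [Finset.sum_comm (s := Finset.univ) (t := Finset.univ) (f := fun (a r : ZMod n) =>
        ((residueCoeff n 1 r * V (a - r * z j) : ℝ) : ℂ) * ZMod.stdAddChar (a * k))]
      refine Finset.sum_congr rfl fun r _ => ?_
      rw [Finset.mul_sum, ← Equiv.sum_comp (Equiv.subRight (r * (z j : ZMod n)))]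
      refine Finset.sum_congr rfl fun a _ => ?_
      simp only [Equiv.subRight_apply]
      rw [show a * k = r * (k * z j) + (a - r * z j) * k by ring, AddChar.map_add_eq_mul]
      push_cast
      ring

/-- Orthogonality of characters keeps only the pairs with `r c + a = 0`, and invertibility of `c`
solves this for `r`. When `V ≥ 0` the dependence on `c` is therefore through nonnegative terms. -/
theorem average_mul_transform [NeZero n] (V : ZMod n → ℝ) (c : (ZMod n)ˣ) (f : ZMod n → ℝ)
    (hf : ∀ k : ZMod n, (f k : ℂ) = ∑ a, (V a : ℂ) * ZMod.stdAddChar (a * k)) :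
    (1 / (n : ℝ)) * ∑ k : ZMod n, bernoulliZMod n (k * (c : ZMod n)) * f k =
      ∑ a, V a * residueCoeff n 1 (-a * (c⁻¹ : (ZMod n)ˣ)) := by
  classical
  have hn : (n : ℂ) ≠ 0 := by exact_mod_cast NeZero.ne n
  have h : ∀ k : ZMod n, ((bernoulliZMod n (k * (c : ZMod n)) * f k : ℝ) : ℂ) = ∑ a, ∑ r,
      (V a : ℂ) * (residueCoeff n 1 r : ℂ) * ZMod.stdAddChar (k * (r * (c : ZMod n) + a)) := by
    intro k
    rw [Complex.ofReal_mul, hf, bernoulliZMod_eq_sum, mul_comm, Finset.sum_mul_sum]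
    refine Finset.sum_congr rfl fun a _ => Finset.sum_congr rfl fun r _ => ?_
    rw [show k * (r * (c : ZMod n) + a) = a * k + r * (k * c) by ring, AddChar.map_add_eq_mul]
    ring
  apply Complex.ofReal_injective
  rw [Complex.ofReal_mul, Complex.ofReal_sum, Finset.sum_congr rfl fun k _ => h k,
    Finset.sum_comm, Complex.ofReal_sum, Finset.mul_sum]
  refine Finset.sum_congr rfl fun a _ => ?_
  rw [Finset.sum_comm]
  simp_rw [← Finset.mul_sum, AddChar.sum_mulShift _ (ZMod.isPrimitive_stdAddChar n)]
  rw [Finset.sum_eq_single (-a * ((c⁻¹ : (ZMod n)ˣ) : ZMod n))]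
  · rw [if_pos (by rw [mul_assoc, Units.inv_mul, mul_one, neg_add_cancel]), ZMod.card]
    push_cast
    field_simp
  · intro r _ hr
    rw [if_neg, Nat.cast_zero, mul_zero]
    intro h'
    apply hr
    rw [← eq_neg_of_add_eq_zero_left h', mul_assoc, Units.mul_inv, mul_one]
  · simp

theorem bernoulliFun_fract_eq [NeZero n] (k z : ℕ) :
    bernoulliFun 2 (Int.fract ((k : ℝ) * (z : ℝ) / (n : ℝ))) =
      bernoulliZMod n ((k : ZMod n) * z) := by
  rw [bernoulliZMod, ← Nat.cast_mul, ← Nat.cast_mul, Int.fract_div_natCast_eq_div_natCast_mod,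
    ZMod.val_natCast]

theorem sum_Icc_natCast_zmod [NeZero n] {M : Type*} [AddCommMonoid M] (g : ZMod n → M) :
    ∑ k ∈ Finset.Icc 1 n, g (k : ZMod n) = ∑ k : ZMod n, g k := by
  have hn := NeZero.pos n
  refine Finset.sum_nbij (fun k => (k : ZMod n)) (fun _ _ => Finset.mem_univ _) ?_ ?_
    (fun _ _ => rfl)
  · intro a ha b hb hab
    simp only [Finset.coe_Icc, Set.mem_Icc] at ha hb
    have h := (ZMod.natCast_eq_natCast_iff' a b n).1 hab
    rcases ha.2.eq_or_lt with h1 | h1 <;> rcases hb.2.eq_or_lt with h2 | h2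
    · omega
    · rw [h1, Nat.mod_self, Nat.mod_eq_of_lt h2] at h; omega
    · rw [h2, Nat.mod_self, Nat.mod_eq_of_lt h1] at h; omega
    · rwa [Nat.mod_eq_of_lt h1, Nat.mod_eq_of_lt h2] at h
  · intro x _
    by_cases hx : x.val = 0
    -- The range `1, …, n` represents the zero class by `n`.
    · exact ⟨n, by simp; omega, by simp [(ZMod.val_eq_zero x).1 hx]⟩
    · exact ⟨x.val, by simp; exact ⟨by omega, (ZMod.val_lt x).le⟩, by simp⟩

/-- The contribution of the coordinates in `u` to the shift-averaged worst-case error. -/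
noncomputable def projectionErrorSq (n : ℕ) [NeZero n] (z : ℕ → ℕ) (u : Finset ℕ) : ℝ :=
  (1 / (n : ℝ)) * ∑ k : ZMod n, ∏ j ∈ u, bernoulliZMod n (k * z j)

theorem shiftAvgErrorSq_eq [NeZero n] (γ : Finset ℕ → ℝ) (d : ℕ) (z : ℕ → ℕ) :
    shiftAvgErrorSq n γ d z =
      ∑ u ∈ (Finset.range d).powerset.erase ∅, γ u * projectionErrorSq n z u := by
  refine Finset.sum_congr rfl fun u _ => ?_
  rw [projectionErrorSq, ← sum_Icc_natCast_zmod]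
  simp_rw [bernoulliFun_fract_eq]

theorem sum_powerset_range_succ_erase_empty (d : ℕ) (f : Finset ℕ → ℝ) :
    ∑ u ∈ (Finset.range (d + 1)).powerset.erase ∅, f u =
      ∑ u ∈ (Finset.range d).powerset.erase ∅, f u +
        ∑ u ∈ (Finset.range d).powerset, f (insert d u) := by
  have h := Finset.sum_powerset_insert (s := Finset.range d) (a := d) (by simp) f
  rw [← Finset.range_add_one] at h
  have h1 := Finset.add_sum_erase (Finset.range (d + 1)).powerset f (Finset.empty_mem_powerset _)
  have h2 := Finset.add_sum_erase (Finset.range d).powerset f (Finset.empty_mem_powerset _)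
  linarith

theorem projectionErrorSq_congr [NeZero n] {z z' : ℕ → ℕ} {u : Finset ℕ} (h : ∀ j ∈ u, z j = z' j) :
    projectionErrorSq n z u = projectionErrorSq n z' u := by
  unfold projectionErrorSq
  congr 1
  exact Finset.sum_congr rfl fun k _ => Finset.prod_congr rfl fun j hj => by rw [h j hj]

/-- The error depends on the last component through a sum with nonnegative terms whose
`ϑ`-th powers are small on average over the units. -/
theorem exists_increment_bound [NeZero n] (h0 : 1 / 2 < ϑ) (h1 : ϑ ≤ 1) {γ : Finset ℕ → ℝ}
    (hγ : ∀ u, 0 ≤ γ u) (z : ℕ → ℕ) (d : ℕ) :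
    ∃ θ : (ZMod n)ˣ → ℝ, (∀ c, 0 ≤ θ c) ∧
      ∑ c, θ c ^ ϑ ≤
        ∑ u ∈ (Finset.range d).powerset, γ (insert d u) ^ ϑ * phi ϑ ^ (insert d u).card ∧
      ∀ (c : ℕ) (hc : Nat.Coprime c n),
        shiftAvgErrorSq n γ (d + 1) (Function.update z d c) =
          shiftAvgErrorSq n γ d z + θ (ZMod.unitOfCoprime c hc) := by
  classical
  have hϑ : 0 < ϑ := by linarith
  choose V hV hVs hVt using exists_transform_prod_bernoulliZMod (n := n) h0 h1 z
  have hnotMem : ∀ u ∈ (Finset.range d).powerset, d ∉ u := fun u hu hd => by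
    simpa using Finset.mem_powerset.1 hu hd
  refine ⟨fun c => ∑ u ∈ (Finset.range d).powerset,
    γ (insert d u) * ∑ a, V u a * residueCoeff n 1 (-a * (c⁻¹ : (ZMod n)ˣ)), fun c => ?_, ?_, ?_⟩
  · exact Finset.sum_nonneg fun u _ => mul_nonneg (hγ _)
      (Finset.sum_nonneg fun a _ => mul_nonneg (hV u a) (residueCoeff_nonneg _))
  · calc ∑ c : (ZMod n)ˣ, (∑ u ∈ (Finset.range d).powerset, γ (insert d u) *
          ∑ a, V u a * residueCoeff n 1 (-a * (c⁻¹ : (ZMod n)ˣ))) ^ ϑ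
        ≤ ∑ c : (ZMod n)ˣ, ∑ u ∈ (Finset.range d).powerset, γ (insert d u) ^ ϑ *
          ∑ a, V u a ^ ϑ * residueCoeff n 1 (-a * (c⁻¹ : (ZMod n)ˣ)) ^ ϑ := by
          refine Finset.sum_le_sum fun c _ => ?_
          have hpos : ∀ u, 0 ≤ ∑ a, V u a * residueCoeff n 1 (-a * (c⁻¹ : (ZMod n)ˣ)) :=
            fun u => Finset.sum_nonneg fun a _ => mul_nonneg (hV u a) (residueCoeff_nonneg _)
          refine (rpow_sum_le_sum_rpow _ (fun u _ => mul_nonneg (hγ _) (hpos u)) hϑ h1).trans ?_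
          refine Finset.sum_le_sum fun u _ => ?_
          rw [Real.mul_rpow (hγ _) (hpos u)]
          refine mul_le_mul_of_nonneg_left ?_ (Real.rpow_nonneg (hγ _) _)
          refine (rpow_sum_le_sum_rpow _ (fun a _ => mul_nonneg (hV u a)
            (residueCoeff_nonneg _)) hϑ h1).trans (Finset.sum_le_sum fun a _ => ?_)
          rw [Real.mul_rpow (hV u a) (residueCoeff_nonneg _)]
      _ = ∑ u ∈ (Finset.range d).powerset, γ (insert d u) ^ ϑ * ∑ a, V u a ^ ϑ *
          ∑ c : (ZMod n)ˣ, residueCoeff n 1 (-a * (c⁻¹ : (ZMod n)ˣ)) ^ ϑ := by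
          rw [Finset.sum_comm]
          refine Finset.sum_congr rfl fun u _ => ?_
          rw [← Finset.mul_sum, Finset.sum_comm]
          simp_rw [Finset.mul_sum]
      _ ≤ ∑ u ∈ (Finset.range d).powerset, γ (insert d u) ^ ϑ * ∑ a, V u a ^ ϑ * phi ϑ := by
          refine Finset.sum_le_sum fun u _ => mul_le_mul_of_nonneg_left
            (Finset.sum_le_sum fun a _ => mul_le_mul_of_nonneg_left ?_
              (Real.rpow_nonneg (hV u a) _)) (Real.rpow_nonneg (hγ _) _)
          -- Inversion permutes the units; the sum over units is then enlarged to all residues, the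
          -- added terms being nonnegative.
          rw [show ∑ c : (ZMod n)ˣ, residueCoeff n 1 (-a * (c⁻¹ : (ZMod n)ˣ)) ^ ϑ =
            ∑ c : (ZMod n)ˣ, residueCoeff n 1 (-a * (c : ZMod n)) ^ ϑ from
            Equiv.sum_comp (Equiv.inv (ZMod n)ˣ)
            (fun c : (ZMod n)ˣ => residueCoeff n 1 (-a * (c : ZMod n)) ^ ϑ)]
          refine le_trans ?_ (sum_residueCoeff_mul_rpow_le h0 h1 (-a))
          rw [← Finset.sum_image (s := Finset.univ) (g := fun c : (ZMod n)ˣ => (c : ZMod n))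
            (f := fun c => residueCoeff n 1 (-a * c) ^ ϑ) (fun c _ c' _ h => Units.ext h)]
          exact Finset.sum_le_sum_of_subset_of_nonneg (Finset.subset_univ _)
            fun c _ _ => Real.rpow_nonneg (residueCoeff_nonneg _) _
      _ ≤ _ := by
          refine Finset.sum_le_sum fun u hu => mul_le_mul_of_nonneg_left ?_
            (Real.rpow_nonneg (hγ _) _)
          rw [← Finset.sum_mul, Finset.card_insert_of_notMem (hnotMem u hu), pow_succ]
          exact mul_le_mul_of_nonneg_right (hVs u) (phi_pos h0).le
  · intro c hc
    rw [shiftAvgErrorSq_eq, shiftAvgErrorSq_eq, sum_powerset_range_succ_erase_empty]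
    congr 1
    · refine Finset.sum_congr rfl fun u hu => ?_
      rw [projectionErrorSq_congr fun j hj => Function.update_of_ne ?_ c z]
      rintro rfl
      exact hnotMem u (Finset.mem_of_mem_erase hu) hj
    · refine Finset.sum_congr rfl fun u hu => ?_
      rw [← average_mul_transform (V u) _ _ (hVt u), projectionErrorSq, ZMod.coe_unitOfCoprime]
      congr 2
      refine Finset.sum_congr rfl fun k _ => ?_
      rw [Finset.prod_insert (hnotMem u hu), Function.update_self]
      congr 1
      refine Finset.prod_congr rfl fun j hj => ?_
      rw [Function.update_of_ne]
      rintro rfl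
      exact hnotMem u hu hj

/-- Induction over the components: the chosen increment is the smallest of all, so its `ϑ`-th power
is at most the mean over the units, and subadditivity of the `ϑ`-th power adds it to the bound for
the earlier components. -/
theorem IsCBC.shiftAvgErrorSq_rpow_le [NeZero n] (h0 : 1 / 2 < ϑ) (h1 : ϑ ≤ 1)
    {γ : Finset ℕ → ℝ} (hγ : ∀ u, 0 ≤ γ u) {s : ℕ} {z : ℕ → ℕ} (hz : IsCBC n γ s z) {d : ℕ}
    (hd : d ≤ s) :
    0 ≤ shiftAvgErrorSq n γ d z ∧ shiftAvgErrorSq n γ d z ^ ϑ ≤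
      (1 / (n.totient : ℝ)) *
        ∑ u ∈ (Finset.range d).powerset.erase ∅, γ u ^ ϑ * phi ϑ ^ u.card := by
  classical
  have hϑ : 0 < ϑ := by linarith
  have hn : (0 : ℝ) < n.totient := by exact_mod_cast Nat.totient_pos.2 (NeZero.pos n)
  induction d with
  | zero => simp [shiftAvgErrorSq, Real.zero_rpow hϑ.ne']
  | succ d ih =>
    obtain ⟨ih0, ih1⟩ := ih (by omega)
    obtain ⟨-, hcop, hmin⟩ := hz d hd
    obtain ⟨θ, hθ, hθs, hθe⟩ := exists_increment_bound (n := n) h0 h1 hγ z d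
    have heq : shiftAvgErrorSq n γ (d + 1) z =
        shiftAvgErrorSq n γ d z + θ (ZMod.unitOfCoprime (z d) hcop) := by
      rw [← hθe (z d) hcop, Function.update_eq_self]
    have hle : ∀ c : (ZMod n)ˣ, θ (ZMod.unitOfCoprime (z d) hcop) ≤ θ c := by
      intro c
      have hc := ZMod.val_coe_unit_coprime c
      have h := hmin (c : ZMod n).val (ZMod.val_lt _) hc
      rw [heq, hθe _ hc] at h
      have hcc : ZMod.unitOfCoprime (c : ZMod n).val hc = c := by
        ext; simp
      rw [hcc] at h
      linarith
    have hav : θ (ZMod.unitOfCoprime (z d) hcop) ^ ϑ ≤ (1 / (n.totient : ℝ)) * ∑ c, θ c ^ ϑ := by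
      rw [one_div_mul_eq_div, le_div_iff₀ hn, mul_comm, ← ZMod.card_units_eq_totient,
        ← nsmul_eq_mul]
      exact Finset.card_nsmul_le_sum _ _ _ fun c _ =>
        Real.rpow_le_rpow (hθ _) (hle c) hϑ.le
    refine ⟨heq ▸ add_nonneg ih0 (hθ _), ?_⟩
    rw [heq, sum_powerset_range_succ_erase_empty, mul_add]
    refine (Real.rpow_add_le_add_rpow ih0 (hθ _) hϑ.le h1).trans (add_le_add ih1 (hav.trans ?_))
    exact mul_le_mul_of_nonneg_left hθs (by positivity)

theorem shiftAvgErrorSq_congr {γ : Finset ℕ → ℝ} {d : ℕ} {z z' : ℕ → ℕ}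
    (h : ∀ j < d, z j = z' j) : shiftAvgErrorSq n γ d z = shiftAvgErrorSq n γ d z' := by
  unfold shiftAvgErrorSq
  refine Finset.sum_congr rfl fun u hu => ?_
  congr 2
  refine Finset.sum_congr rfl fun k _ => Finset.prod_congr rfl fun j hj => ?_
  rw [h j (Finset.mem_range.1 (Finset.mem_powerset.1 (Finset.mem_of_mem_erase hu) hj))]

theorem exists_isCBC (hn : 2 ≤ n) (γ : Finset ℕ → ℝ) (s : ℕ) : ∃ z, IsCBC n γ s z := by
  induction s with
  | zero => exact ⟨0, fun d hd => absurd hd (Nat.not_lt_zero d)⟩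
  | succ s ih =>
    obtain ⟨z, hz⟩ := ih
    obtain ⟨c, hc, hmin⟩ := Finset.exists_min_image
      ((Finset.range n).filter fun c => Nat.Coprime c n)
      -- The residue `1` shows that the set of candidates is nonempty; `1 < n` is where `2 ≤ n`
      -- enters.
      (fun c => shiftAvgErrorSq n γ (s + 1) (Function.update z s c)) ⟨1, by simp; omega⟩
    simp only [Finset.mem_filter, Finset.mem_range] at hc hmin
    refine ⟨Function.update z s c, fun d hd => ?_⟩
    rcases Nat.lt_succ_iff_lt_or_eq.1 hd with h | rfl
    · obtain ⟨h1, h2, h3⟩ := hz d h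
      rw [Function.update_of_ne h.ne]
      refine ⟨h1, h2, fun c' hc' hcop => ?_⟩
      have h4 := h3 c' hc' hcop
      have h5 : shiftAvgErrorSq n γ (d + 1) (Function.update z s c) =
          shiftAvgErrorSq n γ (d + 1) z :=
        shiftAvgErrorSq_congr fun j hj => Function.update_of_ne (by omega) _ _
      have h6 : shiftAvgErrorSq n γ (d + 1) (Function.update (Function.update z s c) d c') =
          shiftAvgErrorSq n γ (d + 1) (Function.update z d c') := by
        refine shiftAvgErrorSq_congr fun j hj => ?_
        rw [Function.update_comm h.ne', Function.update_of_ne (by omega)]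
      rwa [h5, h6]
    · rw [Function.update_self]
      refine ⟨hc.1, hc.2, fun c' hc' hcop => ?_⟩
      rw [Function.update_idem]
      exact hmin c' ⟨hc', hcop⟩

/-! ### The one-dimensional kernel -/

/-- The kernel of the representation `g x = ∫_Y (g t + g' t κ(x, t)) dt`. -/
noncomputable def anovaKernel (x t : ℝ) : ℝ := (if t < x then 1 else 0) - (1 / 2 - t)

theorem abs_anovaKernel_le {x t : ℝ} (ht : t ∈ Y) : |anovaKernel x t| ≤ 1 := by
  obtain ⟨h1, h2⟩ := ht
  rw [anovaKernel, abs_le]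
  split_ifs <;> constructor <;> linarith

theorem measurable_anovaKernel : Measurable fun p : ℝ × ℝ => anovaKernel p.1 p.2 := by
  unfold anovaKernel
  exact (Measurable.ite (measurableSet_lt measurable_snd measurable_fst) measurable_const
    measurable_const).sub (measurable_const.sub measurable_snd)

theorem measurableSet_Y : MeasurableSet Y := measurableSet_Icc

instance isProbabilityMeasure_restrict_Y : IsProbabilityMeasure (volume.restrict Y) :=
  ⟨by rw [Measure.restrict_apply_univ, Y, Real.volume_Icc]; norm_num⟩

instance isProbabilityMeasure_restrict_Ioo :
    IsProbabilityMeasure (volume.restrict (Set.Ioo (0 : ℝ) 1)) :=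
  ⟨by rw [Measure.restrict_apply_univ, Real.volume_Ioo]; norm_num⟩

theorem integral_Y_eq (h : ℝ → ℝ) :
    ∫ t in Y, h t = ∫ t in (-(1 / 2) : ℝ)..(1 / 2), h t := by
  rw [Y, integral_Icc_eq_integral_Ioc, intervalIntegral.integral_of_le (by norm_num)]

theorem setIntegral_Y_ite_lt {c : ℝ} (hc : c ∈ Y) (h : ℝ → ℝ) :
    ∫ t in Y, (if t < c then h t else 0) = ∫ t in (-(1 / 2) : ℝ)..c, h t := by
  have h1 : (fun t => if t < c then h t else 0) = (Set.Iio c).indicator h := by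
    funext t; simp [Set.indicator]
  rw [h1, setIntegral_indicator measurableSet_Iio, intervalIntegral.integral_of_le hc.1,
    ← integral_Icc_eq_integral_Ioc, integral_Icc_eq_integral_Ico]
  congr 2
  ext t
  simp only [Y, Set.mem_inter_iff, Set.mem_Icc, Set.mem_Iio, Set.mem_Ico]
  exact ⟨fun h => ⟨h.1.1, h.2⟩, fun h => ⟨⟨h.1, h.2.le.trans hc.2⟩, h.2⟩⟩

/-- The kernel is `1_{t<x} + (t - 1/2)`. Its first part integrates `g'` to `g x - g (-1/2)`. The
second part, together with `g`, is the derivative of `(t - 1/2) g`, which vanishes at `1/2` and so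
contributes `g (-1/2)`. -/
theorem eq_integral_add_derivWithin_mul_anovaKernel {g : ℝ → ℝ} (hg : ContinuousOn g Y)
    (hd : ∀ t ∈ Y, DifferentiableWithinAt ℝ g Y t) (hg' : ContinuousOn (derivWithin g Y) Y)
    {x : ℝ} (hx : x ∈ Y) :
    g x = ∫ t in Y, (g t + derivWithin g Y t * anovaKernel x t) := by
  have hder : ∀ t ∈ Set.Ioo (-(1 / 2) : ℝ) (1 / 2), HasDerivAt g (derivWithin g Y t) t :=
    fun t ht => (hd t (Set.Ioo_subset_Icc_self ht)).hasDerivWithinAt.hasDerivAt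
      (Icc_mem_nhds ht.1 ht.2)
  have hcomp : IsCompact Y := isCompact_Icc
  have hsub : Set.Icc (-(1 / 2)) x ⊆ Y := Set.Icc_subset_Icc_right hx.2
  have h1 : ∫ t in (-(1 / 2) : ℝ)..x, derivWithin g Y t = g x - g (-(1 / 2)) :=
    intervalIntegral.integral_eq_sub_of_hasDerivAt_of_le hx.1 (hg.mono hsub)
      (fun t ht => hder t ⟨ht.1, ht.2.trans_le hx.2⟩)
      ((hg'.mono (by rw [Set.uIcc_of_le hx.1]; exact hsub)).intervalIntegrable)
  have hc2 : ContinuousOn (fun t => 1 * g t + (t - 1 / 2) * derivWithin g Y t) Y := by fun_prop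
  have h2 : ∫ t in (-(1 / 2) : ℝ)..(1 / 2), (1 * g t + (t - 1 / 2) * derivWithin g Y t) =
      g (-(1 / 2)) := by
    rw [intervalIntegral.integral_eq_sub_of_hasDerivAt_of_le (f := fun t => (t - 1 / 2) * g t)
      (by norm_num) (by unfold Y at hg; fun_prop)
      (fun t ht => ((hasDerivAt_id' t).sub_const (1 / 2)).mul (hder t ht))
      ((hc2.mono (by rw [Set.uIcc_of_le (by norm_num)]; exact subset_rfl)).intervalIntegrable)]
    ring
  rw [← integral_Y_eq] at h2
  rw [← setIntegral_Y_ite_lt hx] at h1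
  have h3 : IntegrableOn (fun t => if t < x then derivWithin g Y t else 0) Y := by
    have : (fun t => if t < x then derivWithin g Y t else 0) =
        (Set.Iio x).indicator (derivWithin g Y) := by
      funext t; simp [Set.indicator]
    rw [this]
    exact (hg'.integrableOn_compact hcomp).indicator measurableSet_Iio
  calc g x = (g x - g (-(1 / 2))) + g (-(1 / 2)) := by ring
    _ = ∫ t in Y, ((if t < x then derivWithin g Y t else 0) +
          (1 * g t + (t - 1 / 2) * derivWithin g Y t)) := by
        rw [integral_add h3 (hc2.integrableOn_compact hcomp), h1, h2]
    _ = _ := by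
        refine integral_congr_ae (Filter.Eventually.of_forall fun t => ?_)
        simp only [anovaKernel]
        split_ifs <;> ring

/-- The closed form of `∫_Y κ(a - 1/2, t) κ(b - 1/2, t) dt`. -/
noncomputable def kernelProduct (a b : ℝ) : ℝ := 1 / 3 + (a ^ 2 + b ^ 2) / 2 - max a b

theorem integral_anovaKernel_mul {a b : ℝ} (ha : a ∈ Set.Icc (0 : ℝ) 1)
    (hb : b ∈ Set.Icc (0 : ℝ) 1) :
    ∫ t in Y, anovaKernel (a - 1 / 2) t * anovaKernel (b - 1 / 2) t = kernelProduct a b := by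
  have hcomp : IsCompact Y := isCompact_Icc
  have haY : a - 1 / 2 ∈ Y := ⟨by linarith [ha.1], by linarith [ha.2]⟩
  have hbY : b - 1 / 2 ∈ Y := ⟨by linarith [hb.1], by linarith [hb.2]⟩
  have hmY : min (a - 1 / 2) (b - 1 / 2) ∈ Y := by
    rcases min_choice (a - 1 / 2) (b - 1 / 2) with h | h <;> rw [h] <;> assumption
  have hint : ∀ c : ℝ, ∀ h : ℝ → ℝ, Continuous h →
      IntegrableOn (fun t => if t < c then h t else 0) Y := by
    intro c h hh
    have : (fun t => if t < c then h t else 0) = (Set.Iio c).indicator h := by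
      funext t; simp [Set.indicator]
    rw [this]
    exact (hh.continuousOn.integrableOn_compact hcomp).indicator measurableSet_Iio
  have hlin : ∀ c : ℝ, ∫ t in (-(1 / 2) : ℝ)..c, (t - 1 / 2) = (c ^ 2 - c) / 2 - 3 / 8 := by
    intro c
    rw [intervalIntegral.integral_sub (by simp) (by simp), integral_id,
      intervalIntegral.integral_const]
    simp only [smul_eq_mul]
    ring
  have hsq : ∫ t in Y, (t - 1 / 2) ^ 2 = 1 / 3 := by
    rw [integral_Y_eq, intervalIntegral.integral_comp_sub_right (fun t => t ^ 2), integral_pow]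
    norm_num
  have hcl : Continuous fun t : ℝ => t - 1 / 2 := by fun_prop
  have h1 := hint (a - 1 / 2) _ hcl
  have h2 := hint (b - 1 / 2) _ hcl
  have h3 := hint (min (a - 1 / 2) (b - 1 / 2)) (fun _ => 1) continuous_const
  have h4 : IntegrableOn (fun t : ℝ => (t - 1 / 2) ^ 2) Y :=
    (by fun_prop : Continuous fun t : ℝ => (t - 1 / 2) ^ 2).continuousOn.integrableOn_compact hcomp
  calc ∫ t in Y, anovaKernel (a - 1 / 2) t * anovaKernel (b - 1 / 2) t
      = ∫ t in Y, ((if t < min (a - 1 / 2) (b - 1 / 2) then (1 : ℝ) else 0) +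
          (if t < a - 1 / 2 then t - 1 / 2 else 0) + (if t < b - 1 / 2 then t - 1 / 2 else 0) +
          (t - 1 / 2) ^ 2) := by
        refine integral_congr_ae (Filter.Eventually.of_forall fun t => ?_)
        simp only [anovaKernel, lt_min_iff]
        by_cases h5 : t < a - 1 / 2 <;> by_cases h6 : t < b - 1 / 2 <;>
          simp only [h5, h6, and_self, and_true, and_false, if_true, if_false] <;> ring
    _ = kernelProduct a b := by
        rw [integral_add ((h3.fun_add h1).fun_add h2) h4, integral_add (h3.fun_add h1) h2, integral_add h3 h1,
          setIntegral_Y_ite_lt hmY, setIntegral_Y_ite_lt haY, setIntegral_Y_ite_lt hbY, hsq, hlin,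
          hlin, intervalIntegral.integral_const, kernelProduct, min_sub_sub_right]
        have := min_add_max a b
        simp only [smul_eq_mul]
        linear_combination this

theorem integral_Ioo_periodic {G : ℝ → ℝ} (hG : Function.Periodic G 1) (q : ℝ) :
    ∫ x in Set.Ioo (0 : ℝ) 1, G (q + x) = ∫ x in (0 : ℝ)..1, G x := by
  rw [← integral_Ioc_eq_integral_Ioo, ← intervalIntegral.integral_of_le zero_le_one,
    intervalIntegral.integral_comp_add_left, add_zero]
  simpa using hG.intervalIntegral_add_eq q 0

theorem integral_fract_add_sq (q : ℝ) :
    ∫ x in Set.Ioo (0 : ℝ) 1, Int.fract (q + x) ^ 2 = 1 / 3 := by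
  rw [integral_Ioo_periodic (G := fun x => Int.fract x ^ 2) (fun x => by simp),
    intervalIntegral.integral_of_le zero_le_one, integral_Ioc_eq_integral_Ioo,
    setIntegral_congr_fun (g := fun x => x ^ 2) measurableSet_Ioo
      (fun x hx => by simp [Int.fract_eq_self.2 ⟨hx.1.le, hx.2⟩]),
    ← integral_Ioc_eq_integral_Ioo, ← intervalIntegral.integral_of_le zero_le_one, integral_pow]
  norm_num

/-- By periodicity only `w = fract (p - q)` matters. For `x < 1 - w` the maximum is `w + x`; beyond
that point `w + x` has wrapped around and the maximum is `x`. -/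
theorem integral_max_fract_add (p q : ℝ) :
    ∫ x in Set.Ioo (0 : ℝ) 1, max (Int.fract (p + x)) (Int.fract (q + x)) =
      1 / 2 + Int.fract (p - q) - Int.fract (p - q) ^ 2 := by
  set w := Int.fract (p - q) with hw
  have hw0 : 0 ≤ w := Int.fract_nonneg _
  have hw1 : w < 1 := Int.fract_lt_one _
  have hG : Function.Periodic (fun x => max (Int.fract (w + x)) (Int.fract x)) 1 := fun x => by
    simp only [← add_assoc, Int.fract_add_one]
  have h1 : ∀ x, max (Int.fract (p + x)) (Int.fract (q + x)) =
      max (Int.fract (w + (q + x))) (Int.fract (q + x)) := by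
    intro x
    have : p + x = w + (q + x) + (⌊p - q⌋ : ℤ) := by
      have := Int.fract_add_floor (p - q)
      rw [← hw] at this
      linear_combination -this
    rw [this, Int.fract_add_intCast]
  simp_rw [h1]
  rw [integral_Ioo_periodic hG q]
  have hA : Set.EqOn (fun x => max (Int.fract (w + x)) (Int.fract x)) (fun x => w + x)
      (Set.Ioo 0 (1 - w)) := by
    intro x hx
    have h2 : Int.fract x = x := Int.fract_eq_self.2 ⟨hx.1.le, by linarith [hx.2]⟩
    have h3 : Int.fract (w + x) = w + x :=
      Int.fract_eq_self.2 ⟨by linarith [hx.1], by linarith [hx.2]⟩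
    simp only [h2, h3]
    exact max_eq_left (by linarith)
  have hB : Set.EqOn (fun x => max (Int.fract (w + x)) (Int.fract x)) (fun x => x)
      (Set.Ioo (1 - w) 1) := by
    intro x hx
    have h2 : Int.fract x = x := Int.fract_eq_self.2 ⟨by linarith [hx.1], hx.2⟩
    have h3 : Int.fract (w + x) = w + x - 1 := by
      rw [← Int.fract_sub_one]
      exact Int.fract_eq_self.2 ⟨by linarith [hx.1], by linarith [hx.2]⟩
    simp only [h2, h3]
    exact max_eq_right (by linarith)
  have hle1 : (0 : ℝ) ≤ 1 - w := by linarith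
  have hle2 : 1 - w ≤ (1 : ℝ) := by linarith
  have hIA : IntervalIntegrable (fun x => max (Int.fract (w + x)) (Int.fract x)) volume 0 (1 - w) :=
    by
      rw [intervalIntegrable_iff_integrableOn_Ioo_of_le hle1]
      refine IntegrableOn.congr_fun ?_ hA.symm measurableSet_Ioo
      exact (by fun_prop : Continuous fun x : ℝ => w + x).integrableOn_Icc.mono_set
        Set.Ioo_subset_Icc_self
  have hIB : IntervalIntegrable (fun x => max (Int.fract (w + x)) (Int.fract x)) volume (1 - w) 1 :=
    by
      rw [intervalIntegrable_iff_integrableOn_Ioo_of_le hle2]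
      refine IntegrableOn.congr_fun ?_ hB.symm measurableSet_Ioo
      exact (continuous_id : Continuous fun x : ℝ => x).integrableOn_Icc.mono_set
        Set.Ioo_subset_Icc_self
  rw [← intervalIntegral.integral_add_adjacent_intervals hIA hIB]
  have hvA : ∫ x in (0 : ℝ)..(1 - w), max (Int.fract (w + x)) (Int.fract x) =
      ∫ x in (0 : ℝ)..(1 - w), (w + x) := by
    rw [intervalIntegral.integral_of_le hle1, integral_Ioc_eq_integral_Ioo,
      setIntegral_congr_fun measurableSet_Ioo hA, ← integral_Ioc_eq_integral_Ioo,
      ← intervalIntegral.integral_of_le hle1]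
  have hvB : ∫ x in (1 - w)..(1 : ℝ), max (Int.fract (w + x)) (Int.fract x) =
      ∫ x in (1 - w)..(1 : ℝ), x := by
    rw [intervalIntegral.integral_of_le hle2, integral_Ioc_eq_integral_Ioo,
      setIntegral_congr_fun measurableSet_Ioo hB, ← integral_Ioc_eq_integral_Ioo,
      ← intervalIntegral.integral_of_le hle2]
  rw [hvA, hvB, intervalIntegral.integral_add (by simp) (by simp), integral_id, integral_id,
    intervalIntegral.integral_const]
  simp only [smul_eq_mul]
  ring

theorem measurable_kernelProduct_fract (p q : ℝ) :
    Measurable fun x => kernelProduct (Int.fract (p + x)) (Int.fract (q + x)) := by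
  unfold kernelProduct
  have h : ∀ r : ℝ, Measurable fun x : ℝ => Int.fract (r + x) := fun r =>
    measurable_fract.comp (measurable_const_add r)
  exact (measurable_const.add ((((h p).pow_const 2).add ((h q).pow_const 2)).div_const 2)).sub
    ((h p).max (h q))

theorem abs_kernelProduct_le {a b : ℝ} (ha : a ∈ Set.Icc (0 : ℝ) 1)
    (hb : b ∈ Set.Icc (0 : ℝ) 1) : |kernelProduct a b| ≤ 2 := by
  obtain ⟨a0, a1⟩ := ha
  obtain ⟨b0, b1⟩ := hb
  have h1 : 0 ≤ max a b := le_max_of_le_left a0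
  have h2 : max a b ≤ 1 := max_le a1 b1
  have h3 : a ^ 2 ≤ 1 := pow_le_one₀ a0 a1
  have h4 : b ^ 2 ≤ 1 := pow_le_one₀ b0 b1
  have h5 := sq_nonneg a
  have h6 := sq_nonneg b
  rw [kernelProduct, abs_le]
  constructor <;> linarith

theorem fract_mem_Icc (x : ℝ) : Int.fract x ∈ Set.Icc (0 : ℝ) 1 :=
  ⟨Int.fract_nonneg _, (Int.fract_lt_one _).le⟩

/-- The reason `B₂` is the shift-averaged kernel: `1/3 + 1/3 - (1/2 + w - w²) = w² - w + 1/6`. -/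
theorem integral_kernelProduct_fract (p q : ℝ) :
    ∫ x in Set.Ioo (0 : ℝ) 1, kernelProduct (Int.fract (p + x)) (Int.fract (q + x)) =
      bernoulliFun 2 (Int.fract (p - q)) := by
  have hm : ∀ r : ℝ, Measurable fun x : ℝ => Int.fract (r + x) := fun r =>
    measurable_fract.comp (measurable_const_add r)
  have hi : ∀ r : ℝ, IntegrableOn (fun x : ℝ => Int.fract (r + x) ^ 2) (Set.Ioo (0 : ℝ) 1) := by
    intro r
    refine Integrable.of_bound ((hm r).pow_const 2).aestronglyMeasurable 1
      (Filter.Eventually.of_forall fun x => ?_)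
    have h := fract_mem_Icc (r + x)
    rw [Real.norm_of_nonneg (sq_nonneg _)]
    exact pow_le_one₀ h.1 h.2
  have hmax : IntegrableOn (fun x : ℝ => max (Int.fract (p + x)) (Int.fract (q + x)))
      (Set.Ioo (0 : ℝ) 1) := by
    refine Integrable.of_bound ((hm p).max (hm q)).aestronglyMeasurable 1
      (Filter.Eventually.of_forall fun x => ?_)
    rw [Real.norm_of_nonneg (le_max_of_le_left (fract_mem_Icc _).1)]
    exact max_le (fract_mem_Icc _).2 (fract_mem_Icc _).2
  unfold kernelProduct
  rw [integral_sub ((integrable_const _).fun_add (((hi p).fun_add (hi q)).div_const 2)) hmax,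
    integral_add (integrable_const _) (((hi p).fun_add (hi q)).div_const 2), integral_const,
    integral_div,
    integral_add (hi p) (hi q), integral_fract_add_sq, integral_fract_add_sq,
    integral_max_fract_add, bernoulliFun_two]
  simp
  ring

/-! ### The representation of a smooth function by its mixed first derivatives -/

/-- Replacing one coordinate by an independent copy preserves a product measure. This isolates a
coordinate without splitting the index type. -/
theorem integral_pi_update {ι : Type*} [Fintype ι] [DecidableEq ι] (μ : Measure ℝ)
    [IsProbabilityMeasure μ] (a : ι) {f : (ι → ℝ) → ℝ}
    (hf : Integrable f (Measure.pi fun _ => μ)) :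
    ∫ t, f t ∂(Measure.pi fun _ => μ) =
      ∫ t, ∫ τ, f (Function.update t a τ) ∂μ ∂(Measure.pi fun _ => μ) := by
  have hm : Measurable fun p : (ι → ℝ) × ℝ => Function.update p.1 a p.2 := by
    refine measurable_pi_iff.2 fun i => ?_
    by_cases h : i = a
    · subst h; simpa using measurable_snd
    · simp only [Function.update_of_ne h]
      exact (measurable_pi_apply i).comp measurable_fst
  have hmp : MeasurePreserving (fun p : (ι → ℝ) × ℝ => Function.update p.1 a p.2)
      ((Measure.pi fun _ => μ).prod μ) (Measure.pi fun _ => μ) := by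
    refine ⟨hm, (Measure.pi_eq fun s hs => ?_).symm⟩
    have hpre : (fun p : (ι → ℝ) × ℝ => Function.update p.1 a p.2) ⁻¹' (Set.univ.pi s) =
        (Set.univ.pi (Function.update s a Set.univ)) ×ˢ s a := by
      ext ⟨t, τ⟩
      simp only [Set.mem_preimage, Set.mem_pi, Set.mem_univ, true_imp_iff, Set.mem_prod]
      constructor
      · intro h
        refine ⟨fun i => ?_, by simpa using h a⟩
        by_cases hi : i = a
        · subst hi; simp
        · simpa [Function.update_of_ne hi] using h i
      · rintro ⟨h1, h2⟩ i
        by_cases hi : i = a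
        · subst hi; simpa using h2
        · simpa [Function.update_of_ne hi] using h1 i
    rw [Measure.map_apply hm (MeasurableSet.univ_pi hs), hpre, Measure.prod_prod, Measure.pi_pi,
      ← Finset.mul_prod_erase _ _ (Finset.mem_univ a),
      ← Finset.mul_prod_erase _ (fun i => μ (s i)) (Finset.mem_univ a), Function.update_self,
      measure_univ, one_mul, mul_comm]
    congr 1
    exact Finset.prod_congr rfl fun i hi => by rw [Function.update_of_ne (Finset.ne_of_mem_erase hi)]
  conv_lhs => rw [← hmp.map_eq]
  rw [integral_map hm.aemeasurable (by rw [hmp.map_eq]; exact hf.aestronglyMeasurable)]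
  exact integral_prod _ (hmp.integrable_comp_of_integrable hf)

/-- The uniform probability measure on `Y^s`. -/
noncomputable def cubeMeasure (s : ℕ) : Measure (Fin s → ℝ) :=
  Measure.pi fun _ => volume.restrict Y

instance isProbabilityMeasure_cubeMeasure (s : ℕ) : IsProbabilityMeasure (cubeMeasure s) := by
  unfold cubeMeasure; infer_instance

theorem cubeMeasure_eq_restrict (s : ℕ) :
    cubeMeasure s = volume.restrict (Set.univ.pi fun _ : Fin s => Y) := by
  rw [cubeMeasure, volume_pi, Measure.restrict_pi_pi]

theorem ae_cubeMeasure_mem (s : ℕ) : ∀ᵐ t ∂(cubeMeasure s), ∀ j, t j ∈ Y := by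
  rw [cubeMeasure_eq_restrict]
  filter_upwards [ae_restrict_mem (MeasurableSet.univ_pi fun _ => measurableSet_Y)] with t ht j
  exact ht j (Set.mem_univ j)

theorem zero_mem_Y : (0 : ℝ) ∈ Y := by constructor <;> norm_num

theorem extendZero_mem_cube {s : ℕ} {t : Fin s → ℝ} (ht : ∀ j, t j ∈ Y) :
    extendZero s t ∈ cube := by
  intro j
  unfold extendZero
  split_ifs with h
  · exact ht _
  · exact zero_mem_Y

theorem extendZero_apply_of_lt {s j : ℕ} (h : j < s) (t : Fin s → ℝ) :
    extendZero s t j = t ⟨j, h⟩ := by simp [extendZero, h]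

theorem measurable_extendZero_apply (s j : ℕ) :
    Measurable fun t : Fin s → ℝ => extendZero s t j := by
  unfold extendZero
  split_ifs with h
  · exact measurable_pi_apply _
  · exact measurable_const

theorem continuous_extendZero_apply (s j : ℕ) :
    Continuous fun t : Fin s → ℝ => extendZero s t j := by
  unfold extendZero
  split_ifs with h
  · exact continuous_apply _
  · exact continuous_const

theorem extendZero_update {s a : ℕ} (ha : a < s) (t : Fin s → ℝ) (τ : ℝ) :
    extendZero s (Function.update t ⟨a, ha⟩ τ) = Function.update (extendZero s t) a τ := by
  funext j
  by_cases hj : j = a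
  · subst hj; simp [extendZero, ha]
  · rw [Function.update_of_ne hj]
    unfold extendZero
    split_ifs with h
    · rw [Function.update_of_ne]; simpa using hj
    · rfl

/-- The mixed first derivative in the coordinates in `u`. -/
noncomputable def mixedPartial (u : Finset ℕ) (F : (ℕ → ℝ) → ℝ) : (ℕ → ℝ) → ℝ :=
  iterPartial (u.sort (· ≤ ·)) F

theorem mixedPartial_empty (F : (ℕ → ℝ) → ℝ) : mixedPartial ∅ F = F := by
  simp [mixedPartial, iterPartial]

/-- Sorting puts the smallest index outermost. Treating coordinates in decreasing order therefore
never requires partial derivatives to commute. -/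
theorem mixedPartial_insert {a : ℕ} {u : Finset ℕ} (h : ∀ b ∈ u, a < b) (F : (ℕ → ℝ) → ℝ) :
    mixedPartial (insert a u) F = pderiv a (mixedPartial u F) := by
  rw [mixedPartial, Finset.sort_insert _ (fun b hb => (h b hb).le) fun ha => (h a ha).ne rfl]
  rfl

/-- The point whose first `a` coordinates are those of `y` and whose others are those of `t`. -/
noncomputable def splice (a : ℕ) (y : ℕ → ℝ) (t : ℕ → ℝ) : ℕ → ℝ := fun j => if j < a then y j else t j

theorem splice_mem_cube (a : ℕ) {y t : ℕ → ℝ} (hy : y ∈ cube) (ht : t ∈ cube) :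
    splice a y t ∈ cube := fun j => by
  unfold splice; split_ifs
  · exact hy j
  · exact ht j

theorem splice_zero (y t : ℕ → ℝ) : splice 0 y t = t := by funext j; simp [splice]

theorem splice_succ (a : ℕ) (y t : ℕ → ℝ) :
    splice (a + 1) y t = Function.update (splice a y t) a (y a) := by
  funext j
  by_cases hj : j = a
  · subst hj; simp [splice]
  · rw [Function.update_of_ne hj]
    have : j < a + 1 ↔ j < a := by omega
    simp only [splice, this]

theorem splice_update (a : ℕ) (y t : ℕ → ℝ) (τ : ℝ) :
    splice a y (Function.update t a τ) = Function.update (splice a y t) a τ := by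
  funext j
  by_cases hj : j = a
  · subst hj; simp [splice]
  · simp only [splice, Function.update_of_ne hj]

theorem update_mem_cube {y : ℕ → ℝ} (hy : y ∈ cube) {a : ℕ} {τ : ℝ} (hτ : τ ∈ Y) :
    Function.update y a τ ∈ cube := fun j => by
  by_cases hj : j = a
  · subst hj; simpa using hτ
  · rw [Function.update_of_ne hj]; exact hy j

theorem SmoothOnCube.eq_integral_update {F : (ℕ → ℝ) → ℝ} (hF : SmoothOnCube F) (l : List ℕ)
    (a : ℕ) {m : ℕ → ℝ} (hm : m ∈ cube) {x : ℝ} (hx : x ∈ Y) :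
    IntegrableOn (fun τ => iterPartial l F (Function.update m a τ) +
        pderiv a (iterPartial l F) (Function.update m a τ) * anovaKernel x τ) Y ∧
    iterPartial l F (Function.update m a x) =
      ∫ τ in Y, (iterPartial l F (Function.update m a τ) +
        pderiv a (iterPartial l F) (Function.update m a τ) * anovaKernel x τ) := by
  set g : ℝ → ℝ := fun τ => iterPartial l F (Function.update m a τ) with hg
  have hcu : Continuous fun τ : ℝ => Function.update m a τ :=
    continuous_const.update a continuous_id
  have hmaps : Set.MapsTo (fun τ : ℝ => Function.update m a τ) Y cube :=
    fun τ hτ => update_mem_cube hm hτ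
  have hg' : ∀ τ, pderiv a (iterPartial l F) (Function.update m a τ) = derivWithin g Y τ := by
    intro τ
    simp [pderiv, hg, Function.update_idem]
  have hgc : ContinuousOn g Y := (hF l).1.comp hcu.continuousOn hmaps
  have hgc' : ContinuousOn (derivWithin g Y) Y := by
    have : derivWithin g Y = fun τ => iterPartial (a :: l) F (Function.update m a τ) :=
      funext fun τ => (hg' τ).symm
    rw [this]
    exact (hF (a :: l)).1.comp hcu.continuousOn hmaps
  have hgd : ∀ τ ∈ Y, DifferentiableWithinAt ℝ g Y τ := by
    intro τ hτ
    have := (hF l).2 a _ (update_mem_cube hm (a := a) hτ)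
    simpa [Function.update_idem] using this
  have hcomp : IsCompact Y := isCompact_Icc
  simp_rw [hg']
  refine ⟨?_, eq_integral_add_derivWithin_mul_anovaKernel hgc hgd hgc' hx⟩
  refine (hgc.integrableOn_compact hcomp).add ((hgc'.integrableOn_compact hcomp).mul_bdd (c := 1)
    (measurable_anovaKernel.comp (measurable_const.prodMk measurable_id)).aestronglyMeasurable ?_)
  filter_upwards [ae_restrict_mem measurableSet_Y] with τ hτ
  exact abs_anovaKernel_le hτ

theorem measurable_prod_anovaKernel {s : ℕ} (u : Finset ℕ) (y : ℕ → ℝ) :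
    Measurable fun t : Fin s → ℝ => ∏ j ∈ u, anovaKernel (y j) (extendZero s t j) :=
  Finset.measurable_prod _ fun j _ =>
    measurable_anovaKernel.comp (measurable_const.prodMk (measurable_extendZero_apply s j))

theorem ae_abs_prod_anovaKernel_le {s : ℕ} (u : Finset ℕ) (y : ℕ → ℝ) :
    ∀ᵐ t ∂(cubeMeasure s), |∏ j ∈ u, anovaKernel (y j) (extendZero s t j)| ≤ 1 := by
  filter_upwards [ae_cubeMeasure_mem s] with t ht
  rw [Finset.abs_prod]
  exact Finset.prod_le_one (fun _ _ => abs_nonneg _)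
    fun j _ => abs_anovaKernel_le (extendZero_mem_cube ht j)

theorem SmoothOnCube.integrable_splice {F : (ℕ → ℝ) → ℝ} (hF : SmoothOnCube F) (l : List ℕ)
    (s a : ℕ) {y : ℕ → ℝ} (hy : y ∈ cube) :
    Integrable (fun t => iterPartial l F (splice a y (extendZero s t))) (cubeMeasure s) := by
  rw [cubeMeasure_eq_restrict]
  refine ContinuousOn.integrableOn_compact (isCompact_univ_pi fun _ => isCompact_Icc) ?_
  refine (hF l).1.comp (Continuous.continuousOn (continuous_pi fun j => ?_)) fun t ht => ?_
  · unfold splice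
    split_ifs
    · exact continuous_const
    · exact continuous_extendZero_apply s j
  · exact splice_mem_cube a hy (extendZero_mem_cube fun j => ht j (Set.mem_univ j))

theorem SmoothOnCube.integrable_splice_mul {F : (ℕ → ℝ) → ℝ} (hF : SmoothOnCube F) (l : List ℕ)
    (s a : ℕ) {y : ℕ → ℝ} (hy : y ∈ cube) (u : Finset ℕ) (x : ℕ → ℝ) :
    Integrable (fun t => iterPartial l F (splice a y (extendZero s t)) *
      ∏ j ∈ u, anovaKernel (x j) (extendZero s t j)) (cubeMeasure s) :=
  (hF.integrable_splice l s a hy).mul_bdd (c := 1)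
    (measurable_prod_anovaKernel u x).aestronglyMeasurable (ae_abs_prod_anovaKernel_le u x)

/-- The coordinates below `a` are frozen at the evaluation point and those from `a` on have been
expanded. Lowering `a` by one applies the one-dimensional identity in coordinate `a`. -/
theorem SmoothOnCube.eq_integral_splice {F : (ℕ → ℝ) → ℝ} (hF : SmoothOnCube F) {s : ℕ}
    {x : Fin s → ℝ} (hx : ∀ j, x j ∈ Y) {a : ℕ} (ha : a ≤ s) :
    F (extendZero s x) = ∫ t, ∑ u ∈ (Finset.Ico a s).powerset,
      mixedPartial u F (splice a (extendZero s x) (extendZero s t)) *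
        ∏ j ∈ u, anovaKernel (extendZero s x j) (extendZero s t j) ∂(cubeMeasure s) := by
  set y := extendZero s x with hy_def
  have hy : y ∈ cube := extendZero_mem_cube hx
  induction ha using Nat.decreasingInduction with
  | self =>
    have : ∀ t, splice s y (extendZero s t) = y := fun t => by
      funext j
      unfold splice
      split_ifs with h
      · rfl
      · simp [hy_def, extendZero, h]
    simp [this, mixedPartial_empty]
  | of_succ a ha ih =>
    have ha' : a < s := ha
    have hint : Integrable (fun t => ∑ u ∈ (Finset.Ico a s).powerset,
      mixedPartial u F (splice a y (extendZero s t)) *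
        ∏ j ∈ u, anovaKernel (y j) (extendZero s t j)) (cubeMeasure s) :=
      integrable_finsetSum _ fun u _ => hF.integrable_splice_mul _ s a hy u y
    rw [ih]
    unfold cubeMeasure at hint ⊢
    rw [integral_pi_update _ ⟨a, ha'⟩ hint]
    refine integral_congr_ae ?_
    filter_upwards [ae_cubeMeasure_mem s] with t ht
    have hm : splice a y (extendZero s t) ∈ cube := splice_mem_cube a hy (extendZero_mem_cube ht)
    have hnot : a ∉ Finset.Ico (a + 1) s := by simp
    have hins : Finset.Ico a s = insert a (Finset.Ico (a + 1) s) := by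
      ext j; simp; omega
    have hinner : ∀ u ∈ (Finset.Ico (a + 1) s).powerset, ∀ τ : ℝ,
        mixedPartial u F (splice a y (extendZero s (Function.update t ⟨a, ha'⟩ τ))) *
            ∏ j ∈ u, anovaKernel (y j) (extendZero s (Function.update t ⟨a, ha'⟩ τ) j) +
          mixedPartial (insert a u) F (splice a y (extendZero s (Function.update t ⟨a, ha'⟩ τ))) *
            ∏ j ∈ insert a u, anovaKernel (y j) (extendZero s (Function.update t ⟨a, ha'⟩ τ) j) =
        (mixedPartial u F (Function.update (splice a y (extendZero s t)) a τ) +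
          pderiv a (mixedPartial u F) (Function.update (splice a y (extendZero s t)) a τ) *
            anovaKernel (y a) τ) * ∏ j ∈ u, anovaKernel (y j) (extendZero s t j) := by
      intro u hu τ
      have hau : ∀ b ∈ u, a < b := fun b hb => by
        have := Finset.mem_Ico.1 (Finset.mem_powerset.1 hu hb)
        omega
      have hprod : ∏ j ∈ u, anovaKernel (y j) (extendZero s (Function.update t ⟨a, ha'⟩ τ) j) =
          ∏ j ∈ u, anovaKernel (y j) (extendZero s t j) :=
        Finset.prod_congr rfl fun j hj => by
          rw [extendZero_update, Function.update_of_ne (hau j hj).ne']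
      rw [Finset.prod_insert fun h => (hau a h).ne rfl, hprod, mixedPartial_insert hau,
        extendZero_update, Function.update_self, splice_update]
      ring
    -- Pairing `u` with `insert a u` produces the integrand `g + g' κ` times a factor free of
    -- coordinate `a`.
    simp_rw [hins, Finset.sum_powerset_insert hnot, ← Finset.sum_add_distrib]
    rw [integral_congr_ae (Filter.Eventually.of_forall fun τ =>
      Finset.sum_congr rfl fun u hu => hinner u hu τ)]
    rw [integral_finsetSum]
    · refine Finset.sum_congr rfl fun u _ => ?_
      rw [integral_mul_const, splice_succ]
      congr 1
      exact (hF.eq_integral_update _ a hm (hy a)).2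
    · intro u _
      exact (hF.eq_integral_update _ a hm (hy a)).1.mul_const _

theorem SmoothOnCube.eq_integral_mixedPartial {F : (ℕ → ℝ) → ℝ} (hF : SmoothOnCube F) {s : ℕ}
    {x : Fin s → ℝ} (hx : ∀ j, x j ∈ Y) :
    F (extendZero s x) = ∫ t, ∑ u ∈ (Finset.range s).powerset, mixedPartial u F (extendZero s t) *
        ∏ j ∈ u, anovaKernel (extendZero s x j) (extendZero s t j) ∂(cubeMeasure s) := by
  have h := hF.eq_integral_splice hx (Nat.zero_le s)
  simpa only [splice_zero, Nat.Ico_zero_eq_range] using h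

/-- The case where the multi-index is the indicator of `u`; only mixed first derivatives enter the
error. -/
theorem GevreyBound.abs_mixedPartial_le {δ CF : ℝ} {β : ℕ → ℝ} {F : (ℕ → ℝ) → ℝ}
    (hF : GevreyBound δ CF β F) (u : Finset ℕ) {ξ : ℕ → ℝ} (hξ : ξ ∈ cube) :
    |mixedPartial u F ξ| ≤ CF * (∏ j ∈ u, β j) * (u.card.factorial : ℝ) ^ δ := by
  classical
  have h := hF ξ hξ (Multiset.toFinsupp u.val)
  have h1 : multiPartial (Multiset.toFinsupp u.val) F = mixedPartial u F := by
    unfold multiPartial mixedPartial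
    rw [Multiset.toFinsupp_toMultiset]
    rfl
  have hsupp : (Multiset.toFinsupp u.val).support = u := by
    rw [Multiset.toFinsupp_support, Finset.val_toFinset]
  have hval : ∀ j ∈ u, Multiset.toFinsupp u.val j = 1 := fun j hj => by
    rw [Multiset.toFinsupp_apply]; exact Multiset.count_eq_one_of_mem u.nodup hj
  have h2 : ((Multiset.toFinsupp u.val).prod fun j k => β j ^ k) = ∏ j ∈ u, β j := by
    rw [Finsupp.prod, hsupp]
    exact Finset.prod_congr rfl fun j hj => by rw [hval j hj, pow_one]
  have h3 : ((Multiset.toFinsupp u.val).sum fun _ k => k) = u.card := by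
    rw [Finsupp.sum, hsupp, Finset.sum_congr rfl hval]; simp
  rwa [h1, h2, h3] at h

/-! ### The shift-averaged error of the lattice rule -/

theorem integral_prod_extendZero {s : ℕ} (μ : Measure ℝ) [IsProbabilityMeasure μ] {u : Finset ℕ}
    (hu : u ⊆ Finset.range s) (f : ℕ → ℝ → ℝ) :
    ∫ t, ∏ j ∈ u, f j (extendZero s t j) ∂(Measure.pi fun _ => μ) = ∏ j ∈ u, ∫ x, f j x ∂μ := by
  have h : ∀ g : ℕ → ℝ, ∏ j ∈ u, g j = ∏ i : Fin s, if (i : ℕ) ∈ u then g i else 1 := by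
    intro g
    rw [← Finset.prod_range (fun j => if j ∈ u then g j else 1), Finset.prod_ite_mem,
      Finset.inter_eq_right.2 hu]
  have h1 : ∀ t : Fin s → ℝ, ∏ j ∈ u, f j (extendZero s t j) =
      ∏ i : Fin s, (fun (i : Fin s) (x : ℝ) => if (i : ℕ) ∈ u then f i x else 1) i (t i) := by
    intro t
    rw [h fun j => f j (extendZero s t j)]
    exact Finset.prod_congr rfl fun i _ => by rw [extendZero_apply_of_lt i.2]
  rw [integral_congr_ae (Filter.Eventually.of_forall h1), h fun j => ∫ x, f j x ∂μ]
  refine (integral_fintype_prod_eq_prod (μ := fun _ : Fin s => μ)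
    fun (i : Fin s) (x : ℝ) => if (i : ℕ) ∈ u then f i x else 1).trans ?_
  refine Finset.prod_congr rfl fun i _ => ?_
  split_ifs <;> simp

/-- The average over the shifted lattice points of the products of kernels. -/
noncomputable def latticeKernel (s n : ℕ) (z : ℕ → ℕ) (u : Finset ℕ) (Δ t : Fin s → ℝ) : ℝ :=
  (1 / (n : ℝ)) * ∑ i ∈ Finset.Icc 1 n, ∏ j ∈ u,
    anovaKernel (Int.fract ((i : ℝ) * (z j : ℝ) / (n : ℝ) + extendZero s Δ j) - 1 / 2)
      (extendZero s t j)

/-- The closed form of `∫ K_u(Δ, t)² dt`. -/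
noncomputable def latticeKernelSq (s n : ℕ) (z : ℕ → ℕ) (u : Finset ℕ) (Δ : Fin s → ℝ) : ℝ :=
  (1 / (n : ℝ)) ^ 2 * ∑ i ∈ Finset.Icc 1 n, ∑ k ∈ Finset.Icc 1 n, ∏ j ∈ u,
    kernelProduct (Int.fract ((i : ℝ) * (z j : ℝ) / (n : ℝ) + extendZero s Δ j))
      (Int.fract ((k : ℝ) * (z j : ℝ) / (n : ℝ) + extendZero s Δ j))

theorem integrable_prod_mul_prod_anovaKernel {s : ℕ} (u : Finset ℕ) (x y : ℕ → ℝ) :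
    Integrable (fun t => (∏ j ∈ u, anovaKernel (x j) (extendZero s t j)) *
      ∏ j ∈ u, anovaKernel (y j) (extendZero s t j)) (cubeMeasure s) := by
  refine Integrable.of_bound ((measurable_prod_anovaKernel u x).mul
    (measurable_prod_anovaKernel u y)).aestronglyMeasurable 1 ?_
  filter_upwards [ae_abs_prod_anovaKernel_le u x, ae_abs_prod_anovaKernel_le u y] with t h1 h2
  rw [Real.norm_eq_abs, abs_mul]
  exact mul_le_one₀ h1 (abs_nonneg _) h2

theorem latticeKernel_sq_eq (s n : ℕ) (z : ℕ → ℕ) (u : Finset ℕ) (Δ t : Fin s → ℝ) :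
    latticeKernel s n z u Δ t ^ 2 = (1 / (n : ℝ)) ^ 2 * ∑ i ∈ Finset.Icc 1 n,
      ∑ k ∈ Finset.Icc 1 n,
      (∏ j ∈ u, anovaKernel
        (Int.fract ((i : ℝ) * (z j : ℝ) / (n : ℝ) + extendZero s Δ j) - 1 / 2)
        (extendZero s t j)) *
      ∏ j ∈ u, anovaKernel
        (Int.fract ((k : ℝ) * (z j : ℝ) / (n : ℝ) + extendZero s Δ j) - 1 / 2)
        (extendZero s t j) := by
  rw [latticeKernel, mul_pow, sq (∑ i ∈ _, _), Finset.sum_mul_sum]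

theorem integrable_latticeKernel_sq (s n : ℕ) (z : ℕ → ℕ) (u : Finset ℕ) (Δ : Fin s → ℝ) :
    Integrable (fun t => latticeKernel s n z u Δ t ^ 2) (cubeMeasure s) := by
  simp_rw [latticeKernel_sq_eq]
  exact (integrable_finsetSum _ fun i _ => integrable_finsetSum _ fun k _ =>
    integrable_prod_mul_prod_anovaKernel u _ _).const_mul _

theorem integral_latticeKernel_sq {s : ℕ} (n : ℕ) (z : ℕ → ℕ) {u : Finset ℕ}
    (hu : u ⊆ Finset.range s) (Δ : Fin s → ℝ) :
    ∫ t, latticeKernel s n z u Δ t ^ 2 ∂(cubeMeasure s) = latticeKernelSq s n z u Δ := by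
  simp_rw [latticeKernel_sq_eq]
  rw [integral_const_mul, integral_finsetSum _ fun i _ => integrable_finsetSum _ fun k _ =>
    integrable_prod_mul_prod_anovaKernel u _ _, latticeKernelSq]
  congr 1
  refine Finset.sum_congr rfl fun i _ => ?_
  rw [integral_finsetSum _ fun k _ => integrable_prod_mul_prod_anovaKernel u _ _]
  refine Finset.sum_congr rfl fun k _ => ?_
  simp_rw [← Finset.prod_mul_distrib]
  rw [cubeMeasure, integral_prod_extendZero _ hu fun j x =>
    anovaKernel (Int.fract ((i : ℝ) * (z j : ℝ) / (n : ℝ) + extendZero s Δ j) - 1 / 2) x *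
    anovaKernel (Int.fract ((k : ℝ) * (z j : ℝ) / (n : ℝ) + extendZero s Δ j) - 1 / 2) x]
  exact Finset.prod_congr rfl fun j _ =>
    integral_anovaKernel_mul (fract_mem_Icc _) (fract_mem_Icc _)

/-- The uniform probability measure on `(0,1)^s`. -/
noncomputable def shiftMeasure (s : ℕ) : Measure (Fin s → ℝ) :=
  Measure.pi fun _ => volume.restrict (Set.Ioo (0 : ℝ) 1)

instance isProbabilityMeasure_shiftMeasure (s : ℕ) : IsProbabilityMeasure (shiftMeasure s) := by
  unfold shiftMeasure; infer_instance

theorem integrable_prod_kernelProduct {s : ℕ} (u : Finset ℕ) (p q : ℕ → ℝ) :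
    Integrable (fun Δ => ∏ j ∈ u, kernelProduct (Int.fract (p j + extendZero s Δ j))
      (Int.fract (q j + extendZero s Δ j))) (shiftMeasure s) := by
  refine Integrable.of_bound (Finset.measurable_prod _ fun j _ =>
    (measurable_kernelProduct_fract (p j) (q j)).comp
      (measurable_extendZero_apply s j)).aestronglyMeasurable (∏ j ∈ u, 2)
    (Filter.Eventually.of_forall fun Δ => ?_)
  rw [Real.norm_eq_abs, Finset.abs_prod]
  exact Finset.prod_le_prod (fun _ _ => abs_nonneg _)
    fun j _ => abs_kernelProduct_le (fract_mem_Icc _) (fract_mem_Icc _)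

theorem integrable_latticeKernelSq (s n : ℕ) (z : ℕ → ℕ) (u : Finset ℕ) :
    Integrable (latticeKernelSq s n z u) (shiftMeasure s) := by
  unfold latticeKernelSq
  exact (integrable_finsetSum _ fun i _ => integrable_finsetSum _ fun k _ =>
    integrable_prod_kernelProduct u _ _).const_mul _

theorem bernoulliFun_fract_sub_eq {n : ℕ} [NeZero n] (i k z : ℕ) :
    bernoulliFun 2 (Int.fract ((i : ℝ) * (z : ℝ) / (n : ℝ) - (k : ℝ) * (z : ℝ) / (n : ℝ))) =
      bernoulliZMod n (((i : ZMod n) - k) * z) := by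
  have h1 : (i : ℝ) * (z : ℝ) / (n : ℝ) - (k : ℝ) * (z : ℝ) / (n : ℝ) =
      (((i : ℤ) - k) * z : ℤ) / (n : ℝ) := by
    push_cast; ring
  have h2 : ((i : ZMod n) - k) * z = (((i : ℤ) - k) * z : ℤ) := by push_cast; ring
  rw [bernoulliZMod, h1, h2, Int.fract_div_intCast_eq_div_intCast_mod, ← ZMod.val_intCast,
    Int.cast_natCast]

/-- After averaging over the shift, a pair of lattice points contributes through `i - k` modulo `n`
only. Each difference occurs `n` times, so the double average collapses to a single one. -/
theorem integral_latticeKernelSq {s n : ℕ} [NeZero n] (z : ℕ → ℕ) {u : Finset ℕ}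
    (hu : u ⊆ Finset.range s) :
    ∫ Δ, latticeKernelSq s n z u Δ ∂(shiftMeasure s) = projectionErrorSq n z u := by
  have hn : (n : ℝ) ≠ 0 := by exact_mod_cast NeZero.ne n
  unfold latticeKernelSq
  rw [integral_const_mul, integral_finsetSum _ fun i _ => integrable_finsetSum _ fun k _ =>
    integrable_prod_kernelProduct u _ _]
  have h : ∀ i k : ℕ, ∫ Δ, ∏ j ∈ u,
      kernelProduct (Int.fract ((i : ℝ) * (z j : ℝ) / (n : ℝ) + extendZero s Δ j))
        (Int.fract ((k : ℝ) * (z j : ℝ) / (n : ℝ) + extendZero s Δ j)) ∂(shiftMeasure s) =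
      ∏ j ∈ u, bernoulliZMod n (((i : ZMod n) - k) * z j) := by
    intro i k
    rw [shiftMeasure, integral_prod_extendZero _ hu fun j x =>
      kernelProduct (Int.fract ((i : ℝ) * (z j : ℝ) / (n : ℝ) + x))
        (Int.fract ((k : ℝ) * (z j : ℝ) / (n : ℝ) + x))]
    exact Finset.prod_congr rfl fun j _ => by
      rw [integral_kernelProduct_fract, bernoulliFun_fract_sub_eq]
  simp_rw [integral_finsetSum _ fun k _ => integrable_prod_kernelProduct u _ _, h]
  rw [sum_Icc_natCast_zmod (fun i : ZMod n => ∑ k ∈ Finset.Icc 1 n,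
    ∏ j ∈ u, bernoulliZMod n ((i - k) * z j))]
  have h2 : ∀ i : ZMod n, ∑ k ∈ Finset.Icc 1 n, ∏ j ∈ u, bernoulliZMod n ((i - k) * z j) =
      ∑ k : ZMod n, ∏ j ∈ u, bernoulliZMod n (k * z j) := fun i =>
    (sum_Icc_natCast_zmod fun k : ZMod n => ∏ j ∈ u, bernoulliZMod n ((i - k) * z j)).trans <|
    Equiv.sum_comp (Equiv.subLeft i) fun k : ZMod n => ∏ j ∈ u, bernoulliZMod n (k * z j)
  simp_rw [h2]
  rw [projectionErrorSq, Finset.sum_const, Finset.card_univ, ZMod.card, nsmul_eq_mul]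
  field_simp

theorem truncIntegral_eq (s : ℕ) (F : (ℕ → ℝ) → ℝ) :
    truncIntegral s F = ∫ t, F (extendZero s t) ∂(cubeMeasure s) := by
  rw [truncIntegral, cubeMeasure_eq_restrict]

theorem SmoothOnCube.latticeRule_sub_truncIntegral {F : (ℕ → ℝ) → ℝ} (hF : SmoothOnCube F)
    (s : ℕ) {n : ℕ} [NeZero n] (z : ℕ → ℕ) (Δ : Fin s → ℝ) :
    (∀ u, Integrable (fun t => mixedPartial u F (extendZero s t) * latticeKernel s n z u Δ t)
      (cubeMeasure s)) ∧
    latticeRule s n z F Δ - truncIntegral s F = ∑ u ∈ (Finset.range s).powerset.erase ∅,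
      ∫ t, mixedPartial u F (extendZero s t) * latticeKernel s n z u Δ t ∂(cubeMeasure s) := by
  have hn : (n : ℝ) ≠ 0 := by exact_mod_cast NeZero.ne n
  set x : ℕ → ℕ → ℝ := fun i j =>
    Int.fract ((i : ℝ) * (z j : ℝ) / (n : ℝ) + extendZero s Δ j) - 1 / 2 with hx
  have h0 : (0 : ℕ → ℝ) ∈ cube := fun _ => zero_mem_Y
  have hint : ∀ (i : ℕ) (u : Finset ℕ), Integrable (fun t => mixedPartial u F (extendZero s t) *
      ∏ j ∈ u, anovaKernel (x i j) (extendZero s t j)) (cubeMeasure s) := fun i u => by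
    simpa only [splice_zero, mixedPartial] using hF.integrable_splice_mul (u.sort (· ≤ ·)) s 0 h0 u (x i)
  have hmul : ∀ (u : Finset ℕ) (t : Fin s → ℝ),
      mixedPartial u F (extendZero s t) * latticeKernel s n z u Δ t =
      (1 / (n : ℝ)) * ∑ i ∈ Finset.Icc 1 n, mixedPartial u F (extendZero s t) *
        ∏ j ∈ u, anovaKernel (x i j) (extendZero s t j) := by
    intro u t
    rw [latticeKernel, mul_left_comm, Finset.mul_sum]
  have hI : ∀ u, Integrable (fun t => mixedPartial u F (extendZero s t) *
      latticeKernel s n z u Δ t) (cubeMeasure s) := fun u => by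
    simp_rw [hmul]
    exact (integrable_finsetSum _ fun i _ => hint i u).const_mul _
  refine ⟨hI, ?_⟩
  have hpt : ∀ i : ℕ,
      F (extendZero s fun j => Int.fract ((i : ℝ) * (z j : ℝ) / (n : ℝ) + Δ j) - 1 / 2) =
      ∑ u ∈ (Finset.range s).powerset, ∫ t, mixedPartial u F (extendZero s t) *
        ∏ j ∈ u, anovaKernel (x i j) (extendZero s t j) ∂(cubeMeasure s) := by
    intro i
    rw [hF.eq_integral_mixedPartial, ← integral_finsetSum _ fun u _ => hint i u]
    · refine integral_congr_ae (Filter.Eventually.of_forall fun t =>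
        Finset.sum_congr rfl fun u hu => ?_)
      congr 1
      refine Finset.prod_congr rfl fun j hj => ?_
      have hjs : j < s := Finset.mem_range.1 (Finset.mem_powerset.1 hu hj)
      rw [extendZero_apply_of_lt hjs, hx]
      simp only [extendZero_apply_of_lt hjs]
    · intro j
      have h := fract_mem_Icc ((i : ℝ) * (z j : ℝ) / (n : ℝ) + Δ j)
      exact ⟨by linarith [h.1], by linarith [h.2]⟩
  have hQ : latticeRule s n z F Δ = ∑ u ∈ (Finset.range s).powerset,
      ∫ t, mixedPartial u F (extendZero s t) * latticeKernel s n z u Δ t ∂(cubeMeasure s) := by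
    rw [latticeRule, Finset.sum_congr rfl fun i _ => hpt i, Finset.sum_comm, Finset.mul_sum]
    refine Finset.sum_congr rfl fun u _ => ?_
    simp_rw [hmul]
    rw [integral_const_mul, integral_finsetSum _ fun i _ => hint i u]
  -- An empty product of kernels is `1`, so this term integrates `F` exactly.
  have hempty : ∫ t, mixedPartial ∅ F (extendZero s t) * latticeKernel s n z ∅ Δ t ∂(cubeMeasure s) =
      truncIntegral s F := by
    rw [truncIntegral_eq]
    refine integral_congr_ae (Filter.Eventually.of_forall fun t => ?_)
    simp [mixedPartial_empty, latticeKernel, hn]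
  rw [hQ, ← Finset.add_sum_erase _ _ (Finset.empty_mem_powerset _), hempty, add_sub_cancel_left]

/-- The variance of `|f|` is nonnegative. -/
theorem sq_integral_abs_le {Ω : Type*} [MeasurableSpace Ω] {μ : Measure Ω}
    [IsProbabilityMeasure μ] {f : Ω → ℝ} (hf : AEStronglyMeasurable f μ)
    (hf2 : Integrable (fun x => f x ^ 2) μ) : (∫ x, |f x| ∂μ) ^ 2 ≤ ∫ x, f x ^ 2 ∂μ := by
  have hL : MemLp f 2 μ := (memLp_two_iff_integrable_sq hf).2 hf2
  have h1 : Integrable (fun x => |f x|) μ := (hL.integrable (by norm_num)).abs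
  set c := ∫ x, |f x| ∂μ with hc
  have h2 : 0 ≤ ∫ x, (f x ^ 2 - 2 * c * |f x| + c ^ 2) ∂μ := by
    refine integral_nonneg fun x => ?_
    have : f x ^ 2 - 2 * c * |f x| + c ^ 2 = (|f x| - c) ^ 2 := by rw [← sq_abs (f x)]; ring
    simp only [this, Pi.zero_apply]
    positivity
  have h3 : Integrable (fun x => f x ^ 2 - 2 * c * |f x|) μ := hf2.sub (h1.const_mul _)
  rw [integral_add h3 (integrable_const _),
    integral_sub hf2 (h1.const_mul _), integral_const_mul, integral_const, ← hc] at h2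
  simp only [probReal_univ, smul_eq_mul, one_mul] at h2
  nlinarith

theorem measurable_latticeKernel (s n : ℕ) (z : ℕ → ℕ) (u : Finset ℕ) (Δ : Fin s → ℝ) :
    Measurable (latticeKernel s n z u Δ) := by
  unfold latticeKernel
  exact (Finset.measurable_sum _ fun i _ => measurable_prod_anovaKernel u _).const_mul _

/-- The uniform derivative bound is pulled out of each integral, leaving the `L¹` norm of the
lattice kernel. Cauchy–Schwarz over `u` with weights `γ`, then `L¹ ≤ L²` on a probability space,
give the two factors. -/
theorem GevreyBound.sq_error_le {δ CF : ℝ} {β : ℕ → ℝ} {F : (ℕ → ℝ) → ℝ} (hs : SmoothOnCube F)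
    (hF : GevreyBound δ CF β F) (hCF : 0 ≤ CF) (hβ : ∀ j, 0 ≤ β j) {γ : Finset ℕ → ℝ}
    (hγ : ∀ u, 0 < γ u) (s : ℕ) {n : ℕ} [NeZero n] (z : ℕ → ℕ) (Δ : Fin s → ℝ) :
    |truncIntegral s F - latticeRule s n z F Δ| ^ 2 ≤
      (∑ u ∈ (Finset.range s).powerset.erase ∅,
        (CF * (∏ j ∈ u, β j) * (u.card.factorial : ℝ) ^ δ) ^ 2 / γ u) *
      ∑ u ∈ (Finset.range s).powerset.erase ∅, γ u * latticeKernelSq s n z u Δ := by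
  obtain ⟨hI, hsum⟩ := hs.latticeRule_sub_truncIntegral s (n := n) z Δ
  set B : Finset ℕ → ℝ := fun u => CF * (∏ j ∈ u, β j) * (u.card.factorial : ℝ) ^ δ with hB
  have hB0 : ∀ u, 0 ≤ B u := fun u =>
    mul_nonneg (mul_nonneg hCF (Finset.prod_nonneg fun j _ => hβ j)) (by positivity)
  set a : Finset ℕ → ℝ := fun u => ∫ t, |latticeKernel s n z u Δ t| ∂(cubeMeasure s) with ha
  have ha0 : ∀ u, 0 ≤ a u := fun u => integral_nonneg fun t => abs_nonneg _
  have hterm : ∀ u, |∫ t, mixedPartial u F (extendZero s t) * latticeKernel s n z u Δ t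
      ∂(cubeMeasure s)| ≤ B u * a u := by
    intro u
    have hL : Integrable (fun t => |latticeKernel s n z u Δ t|) (cubeMeasure s) :=
      (((memLp_two_iff_integrable_sq (measurable_latticeKernel s n z u Δ).aestronglyMeasurable).2
        (integrable_latticeKernel_sq s n z u Δ)).integrable (by norm_num)).abs
    refine (abs_integral_le_integral_abs).trans ?_
    rw [ha, ← integral_const_mul]
    refine integral_mono_ae (hI u).abs (hL.const_mul _) ?_
    filter_upwards [ae_cubeMeasure_mem s] with t ht
    rw [abs_mul]
    exact mul_le_mul_of_nonneg_right (hF.abs_mixedPartial_le u (extendZero_mem_cube ht))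
      (abs_nonneg _)
  have h1 : |truncIntegral s F - latticeRule s n z F Δ| ≤
      ∑ u ∈ (Finset.range s).powerset.erase ∅, B u * a u := by
    rw [abs_sub_comm, hsum]
    exact (Finset.abs_sum_le_sum_abs _ _).trans (Finset.sum_le_sum fun u _ => hterm u)
  have h2 : (∑ u ∈ (Finset.range s).powerset.erase ∅, B u * a u) ^ 2 ≤
      (∑ u ∈ (Finset.range s).powerset.erase ∅, B u ^ 2 / γ u) *
        ∑ u ∈ (Finset.range s).powerset.erase ∅, γ u * a u ^ 2 := by
    refine Finset.sum_sq_le_sum_mul_sum_of_sq_le_mul _ (fun u _ => ?_) (fun u _ => ?_)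
      fun u _ => ?_
    · have := hγ u; positivity
    · have := hγ u; positivity
    · have := (hγ u).ne'
      refine le_of_eq ?_
      field_simp
  refine (pow_le_pow_left₀ (abs_nonneg _) h1 2).trans (h2.trans ?_)
  refine mul_le_mul_of_nonneg_left (Finset.sum_le_sum fun u hu =>
    mul_le_mul_of_nonneg_left ?_ (hγ u).le) (Finset.sum_nonneg fun u _ => ?_)
  · rw [← integral_latticeKernel_sq n z
      (Finset.mem_powerset.1 (Finset.mem_of_mem_erase hu)) Δ]
    exact sq_integral_abs_le (measurable_latticeKernel s n z u Δ).aestronglyMeasurable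
      (integrable_latticeKernel_sq s n z u Δ)
  · have := hγ u; positivity

theorem GevreyBound.rmse_sq_le {δ CF : ℝ} {β : ℕ → ℝ} {F : (ℕ → ℝ) → ℝ} (hs : SmoothOnCube F)
    (hF : GevreyBound δ CF β F) (hCF : 0 ≤ CF) (hβ : ∀ j, 0 ≤ β j) {γ : Finset ℕ → ℝ}
    (hγ : ∀ u, 0 < γ u) (s : ℕ) {n : ℕ} [NeZero n] (z : ℕ → ℕ) :
    rmse s n z F ^ 2 ≤
      (∑ u ∈ (Finset.range s).powerset.erase ∅,
        (CF * (∏ j ∈ u, β j) * (u.card.factorial : ℝ) ^ δ) ^ 2 / γ u) *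
      shiftAvgErrorSq n γ s z := by
  rw [rmse, Real.sq_sqrt (integral_nonneg fun Δ => by positivity)]
  have hμ : volume.restrict (Set.univ.pi fun _ : Fin s => Set.Ioo (0 : ℝ) 1) = shiftMeasure s := by
    rw [shiftMeasure, volume_pi, Measure.restrict_pi_pi]
  rw [hμ]
  have hint : ∀ u ∈ (Finset.range s).powerset.erase ∅,
      Integrable (fun Δ => γ u * latticeKernelSq s n z u Δ) (shiftMeasure s) := fun u _ =>
    (integrable_latticeKernelSq s n z u).const_mul _
  -- Only the majorant has to be integrable in `Δ`; nothing is needed about measurability of the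
  -- error itself.
  refine (integral_mono_of_nonneg (Filter.Eventually.of_forall fun Δ => by positivity)
    ((integrable_finsetSum _ hint).const_mul _)
    (Filter.Eventually.of_forall fun Δ => hF.sq_error_le hs hCF hβ hγ s z Δ)).trans (le_of_eq ?_)
  rw [integral_const_mul, integral_finsetSum _ hint, shiftAvgErrorSq_eq]
  congr 1
  refine Finset.sum_congr rfl fun u hu => ?_
  rw [integral_const_mul, integral_latticeKernelSq z
    (Finset.mem_powerset.1 (Finset.mem_of_mem_erase hu))]

/-! ### The choice of the weights -/

theorem weight_pos {δ ϑ : ℝ} {β : ℕ → ℝ} (h0 : 1 / 2 < ϑ) (hβ : ∀ j, 0 < β j) (u : Finset ℕ) :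
    0 < weight δ ϑ β u := by
  have hφ := phi_pos h0
  refine Real.rpow_pos_of_pos (mul_pos (by positivity) (Finset.prod_pos fun j _ => ?_)) _
  exact div_pos (hβ j) (Real.sqrt_pos.2 hφ)

theorem weight_rpow_mul_phi_pow {δ ϑ : ℝ} {β : ℕ → ℝ} (hβ : ∀ j, 0 < β j)
    (u : Finset ℕ) :
    weight δ ϑ β u ^ ϑ * phi ϑ ^ u.card = (u.card.factorial : ℝ) ^ (δ * (2 * ϑ / (1 + ϑ))) *
      ∏ j ∈ u, (β j / Real.sqrt (phi ϑ)) ^ (2 * ϑ / (1 + ϑ)) * phi ϑ := by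
  have hb : ∀ j, 0 ≤ β j / Real.sqrt (phi ϑ) := fun j => div_nonneg (hβ j).le (Real.sqrt_nonneg _)
  have hp : 0 ≤ ∏ j ∈ u, β j / Real.sqrt (phi ϑ) := Finset.prod_nonneg fun j _ => hb j
  rw [weight, ← Real.rpow_mul (by positivity), Real.mul_rpow (by positivity) hp,
    ← Real.rpow_mul (by positivity), Finset.prod_mul_distrib, Finset.prod_const,
    Real.finsetProd_rpow _ _ fun j _ => hb j, mul_assoc, div_mul_eq_mul_div]

/-- The exponent `2/(1+ϑ)` is chosen so that `γ^(1+ϑ)` is the square of the base; this balances the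
two factors of the error bound, and one sum controls both. -/
theorem sq_div_weight {δ ϑ : ℝ} {β : ℕ → ℝ} (h0 : 1 / 2 < ϑ) (hβ : ∀ j, 0 < β j) (CF : ℝ)
    (u : Finset ℕ) :
    (CF * (∏ j ∈ u, β j) * (u.card.factorial : ℝ) ^ δ) ^ 2 / weight δ ϑ β u =
      CF ^ 2 * (weight δ ϑ β u ^ ϑ * phi ϑ ^ u.card) := by
  have hφ := phi_pos h0
  have hw := weight_pos (δ := δ) h0 hβ u
  have hb : ∀ j, 0 < β j / Real.sqrt (phi ϑ) := fun j => div_pos (hβ j) (Real.sqrt_pos.2 hφ)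
  set a := (u.card.factorial : ℝ) ^ δ * ∏ j ∈ u, β j / Real.sqrt (phi ϑ) with ha
  have ha0 : 0 < a := mul_pos (by positivity) (Finset.prod_pos fun j _ => hb j)
  have h1 : weight δ ϑ β u ^ ϑ * weight δ ϑ β u = a ^ 2 := by
    have h2 : weight δ ϑ β u = a ^ (2 / (1 + ϑ)) := rfl
    rw [h2, ← Real.rpow_mul ha0.le, ← Real.rpow_add ha0, ← Real.rpow_natCast]
    congr 1
    have : 1 + ϑ ≠ 0 := by linarith
    push_cast
    field_simp
    ring
  have h3 : (∏ j ∈ u, β j) ^ 2 * ((u.card.factorial : ℝ) ^ δ) ^ 2 = a ^ 2 * phi ϑ ^ u.card := by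
    rw [ha, Finset.prod_div_distrib, Finset.prod_const, mul_pow, div_pow, ← pow_mul,
      mul_comm u.card 2, pow_mul, Real.sq_sqrt hφ.le]
    field_simp
  rw [div_eq_iff hw.ne', mul_pow, mul_pow, mul_assoc, h3, ← h1]
  ring

theorem summable_rpow_of_le {β : ℕ → ℝ} {p r : ℝ} (hβ : ∀ j, 0 < β j) (hp : 0 < p) (hpr : p ≤ r)
    (hs : Summable fun j => β j ^ p) : Summable fun j => β j ^ r := by
  refine summable_of_isBigO_nat hs (Asymptotics.IsBigO.of_bound 1 ?_)
  filter_upwards [hs.tendsto_atTop_zero.eventually (gt_mem_nhds one_pos)] with j hj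
  have h1 : β j ≤ 1 := by
    by_contra h
    exact absurd hj (not_lt.2 (Real.one_le_rpow (not_le.1 h).le hp.le))
  rw [Real.norm_of_nonneg (Real.rpow_nonneg (hβ j).le _),
    Real.norm_of_nonneg (Real.rpow_nonneg (hβ j).le _), one_mul]
  exact Real.rpow_le_rpow_of_exponent_ge (hβ j) h1 hpr

/-- The sums `∑_u γ_u^ϑ φ(ϑ)^{|u|}` are bounded independently of the dimension. -/
theorem exists_bound_sum_weight {δ p ϑ : ℝ} {β : ℕ → ℝ} (hδ : 1 ≤ δ) (hp : 0 < p)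
    (hβpos : ∀ j, 0 < β j) (hβ : Summable fun j => β j ^ p)
    (hcrit : p = 1 / δ → (∑' j, β j ^ p) ^ (1 / p) < Real.sqrt 6)
    (h0 : 1 / 2 < ϑ) (h1 : ϑ ≤ 1) (hpq : p ≤ 2 * ϑ / (1 + ϑ) / δ) (hϑp : ϑ = 1 → p = 1 / δ) :
    ∃ S : ℝ, 0 < S ∧ ∀ s : ℕ, ∑ u ∈ (Finset.range s).powerset.erase ∅,
      weight δ ϑ β u ^ ϑ * phi ϑ ^ u.card ≤ S := by
  have hφ := phi_pos h0
  have hδ0 : 0 < δ := by linarith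
  have hϑ1 : 0 < 1 + ϑ := by linarith
  have hq1 : 2 * ϑ / (1 + ϑ) ≤ 1 := by rw [div_le_one hϑ1]; linarith
  have hb : ∀ j, 0 ≤ β j / Real.sqrt (phi ϑ) :=
    fun j => div_nonneg (hβpos j).le (Real.sqrt_nonneg _)
  set q := 2 * ϑ / (1 + ϑ) with hq
  set x : ℕ → ℝ := fun j => (β j / Real.sqrt (phi ϑ)) ^ q * phi ϑ with hx
  have hx0 : ∀ j, 0 ≤ x j := fun j => mul_nonneg (Real.rpow_nonneg (hb j) _) hφ.le
  have hxe : ∀ j, x j ^ (1 / δ) =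
      β j ^ (q / δ) * (phi ϑ / Real.sqrt (phi ϑ) ^ q) ^ (1 / δ) := by
    intro j
    have : x j = β j ^ q * (phi ϑ / Real.sqrt (phi ϑ) ^ q) := by
      rw [hx]
      simp only
      rw [Real.div_rpow (hβpos j).le (Real.sqrt_nonneg _)]
      ring
    rw [this, Real.mul_rpow (Real.rpow_nonneg (hβpos j).le _) (by positivity),
      ← Real.rpow_mul (hβpos j).le, mul_one_div]
  have hsum : Summable fun j => x j ^ (1 / δ) := by
    simp_rw [hxe]
    exact (summable_rpow_of_le hβpos hp hpq hβ).mul_right _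
  -- Here `q = 1` forces `ϑ = 1` and `p = 1/δ`. The ratio of the geometric series is then the `ℓ^p`
  -- norm of `β` times `√φ(1) = 1/√6`.
  obtain ⟨S, hS, hSb⟩ := exists_bound_sum_powerset hδ hq1 hx0 hsum (fun hq1' => by
    have hϑ1' : ϑ = 1 := by
      rw [hq, div_eq_one_iff_eq hϑ1.ne'] at hq1'
      linarith
    have hpd := hϑp hϑ1'
    have hcr := hcrit hpd
    simp_rw [hxe, hq1']
    rw [tsum_mul_right, ← hpd, Real.rpow_one, Real.mul_rpow
      (tsum_nonneg fun j => Real.rpow_nonneg (hβpos j).le _) (by positivity),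
      ← Real.rpow_mul (by positivity)]
    have h2 : δ = 1 / p := by rw [hpd]; field_simp
    have h3 : p * δ = 1 := by rw [hpd]; field_simp
    rw [h3, Real.rpow_one, Real.div_sqrt, hϑ1', phi_one, h2, Real.sqrt_div zero_le_one,
      Real.sqrt_one, mul_one_div, div_lt_one (by positivity)]
    exact hcr)
  refine ⟨S, hS, fun s => ?_⟩
  refine le_trans ?_ (hSb s)
  simp_rw [weight_rpow_mul_phi_pow hβpos]
  exact Finset.sum_le_sum_of_subset_of_nonneg (Finset.erase_subset _ _) fun u _ _ =>
    mul_nonneg (by positivity) (Finset.prod_nonneg fun j _ => hx0 j)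

/-- In the first case `ϑ > 1/2` gives `2ϑ/(1+ϑ) > 2/3 ≥ δp`. In the second, `ϑ` solves `2ϑ/(1+ϑ) =
δp`, and it reaches `1` only at `p = 1/δ`. -/
theorem exponent_bounds {δ p ϑ : ℝ} (hδ : 1 ≤ δ) (hpδ : p ≤ 1 / δ)
    (hϑ : (p ≤ 2 / (3 * δ) ∧ 1 / 2 < ϑ ∧ ϑ < 1) ∨
      (2 / (3 * δ) < p ∧ ϑ = δ * p / (2 - δ * p))) :
    1 / 2 < ϑ ∧ ϑ ≤ 1 ∧ p ≤ 2 * ϑ / (1 + ϑ) / δ ∧ (ϑ = 1 → p = 1 / δ) := by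
  have hδ0 : 0 < δ := by linarith
  rcases hϑ with ⟨h1, h2, h3⟩ | ⟨h1, h2⟩
  · refine ⟨h2, h3.le, h1.trans ?_, fun h => absurd h h3.ne⟩
    rw [← div_div]
    refine div_le_div_of_nonneg_right ?_ hδ0.le
    rw [div_le_div_iff₀ (by norm_num) (by linarith)]
    linarith
  · rw [div_lt_iff₀ (by positivity)] at h1
    rw [le_div_iff₀ hδ0] at hpδ
    have h4 : 0 < 2 - δ * p := by linarith
    refine ⟨?_, ?_, ?_, ?_⟩
    · rw [h2, div_lt_div_iff₀ two_pos h4]; linarith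
    · rw [h2, div_le_one h4]; linarith
    · refine le_of_eq ?_
      have h5 : 1 + ϑ = 2 / (2 - δ * p) := by rw [h2]; field_simp; ring
      have h6 : 2 - p * δ ≠ 0 := by rw [mul_comm]; exact h4.ne'
      rw [h5, h2]
      field_simp
    · intro h
      rw [h2, div_eq_one_iff_eq h4.ne'] at h
      rw [eq_div_iff hδ0.ne']
      linarith

theorem GevreyBound.rmse_le_of_isCBC {δ CF ϑ S : ℝ} {β : ℕ → ℝ} (h0 : 1 / 2 < ϑ) (h1 : ϑ ≤ 1)
    (hCF : 0 < CF) (hβ : ∀ j, 0 < β j) (hS0 : 0 < S)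
    {s : ℕ} (hS : ∑ u ∈ (Finset.range s).powerset.erase ∅,
      weight δ ϑ β u ^ ϑ * phi ϑ ^ u.card ≤ S)
    {n : ℕ} [NeZero n] {z : ℕ → ℕ} (hz : IsCBC n (weight δ ϑ β) s z)
    {F : (ℕ → ℝ) → ℝ} (hs : SmoothOnCube F) (hF : GevreyBound δ CF β F) :
    rmse s n z F ≤ (CF ^ 2 * S * S ^ (1 / ϑ)) ^ ((1 : ℝ) / 2) *
      (n.totient : ℝ) ^ (-(1 / (2 * ϑ))) := by
  have hϑ : 0 < ϑ := by linarith
  have hn : (0 : ℝ) < n.totient := by exact_mod_cast Nat.totient_pos.2 (NeZero.pos n)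
  obtain ⟨he0, he⟩ := hz.shiftAvgErrorSq_rpow_le (γ := weight δ ϑ β) h0 h1
    (fun u => (weight_pos h0 hβ u).le) le_rfl
  have he1 : shiftAvgErrorSq n (weight δ ϑ β) s z ≤
      S ^ (1 / ϑ) * (n.totient : ℝ) ^ (-(1 / ϑ)) := by
    calc shiftAvgErrorSq n (weight δ ϑ β) s z
        = (shiftAvgErrorSq n (weight δ ϑ β) s z ^ ϑ) ^ (1 / ϑ) := by
          rw [← Real.rpow_mul he0, mul_one_div_cancel hϑ.ne', Real.rpow_one]
      _ ≤ (1 / (n.totient : ℝ) * S) ^ (1 / ϑ) :=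
          Real.rpow_le_rpow (Real.rpow_nonneg he0 _)
            (he.trans (mul_le_mul_of_nonneg_left hS (by positivity))) (by positivity)
      _ = _ := by
          rw [Real.mul_rpow (by positivity) hS0.le, Real.div_rpow zero_le_one hn.le,
            Real.one_rpow, Real.rpow_neg hn.le, one_div ((n.totient : ℝ) ^ (1 / ϑ)), mul_comm]
  have h2 := hF.rmse_sq_le hs hCF.le (fun j => (hβ j).le)
    (γ := weight δ ϑ β) (fun u => weight_pos h0 hβ u) s (n := n) z
  simp_rw [sq_div_weight h0 hβ, ← Finset.mul_sum] at h2
  -- After squaring, the bound is the product of `CF² S` and `(S / totient n)^(1/ϑ)`.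
  refine (pow_le_pow_iff_left₀ (Real.sqrt_nonneg _) (by positivity) two_ne_zero).1 ?_
  rw [← rmse]
  calc rmse s n z F ^ 2 ≤ CF ^ 2 * S * (S ^ (1 / ϑ) * (n.totient : ℝ) ^ (-(1 / ϑ))) :=
        h2.trans (mul_le_mul (mul_le_mul_of_nonneg_left hS (by positivity)) he1 he0
          (by positivity))
    _ = _ := by
        rw [mul_pow, ← Real.rpow_natCast (_ ^ ((1 : ℝ) / 2)),
          ← Real.rpow_natCast (_ ^ (-(1 / (2 * ϑ)))), ← Real.rpow_mul (by positivity),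
          ← Real.rpow_mul hn.le]
        have h3 : (1 : ℝ) / 2 * ((2 : ℕ) : ℝ) = 1 := by norm_num
        have h4 : -(1 / (2 * ϑ)) * ((2 : ℕ) : ℝ) = -(1 / ϑ) := by push_cast; field_simp
        rw [h3, h4, Real.rpow_one]
        ring

end GevreyQMC

theorem mainTheorem3 (δ p CF ϑ : ℝ) (β : ℕ → ℝ)
    (hδ : 1 ≤ δ) (hp : 0 < p) (hpδ : p ≤ 1 / δ) (hCF : 0 < CF)
    (hβpos : ∀ j, 0 < β j) (hβ : Summable fun j => β j ^ p)
    (hcrit : p = 1 / δ → (∑' j, β j ^ p) ^ (1 / p) < Real.sqrt 6)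
    (hϑ : (p ≤ 2 / (3 * δ) ∧ 1 / 2 < ϑ ∧ ϑ < 1) ∨
      (2 / (3 * δ) < p ∧ ϑ = δ * p / (2 - δ * p))) :
    ∃ C : ℝ, 0 < C ∧ ∀ s m : ℕ, 1 ≤ m →
      (∃ z : ℕ → ℕ, GevreyQMC.IsCBC (2 ^ m) (GevreyQMC.weight δ ϑ β) s z) ∧
      ∀ z : ℕ → ℕ, GevreyQMC.IsCBC (2 ^ m) (GevreyQMC.weight δ ϑ β) s z →
        ∀ F : (ℕ → ℝ) → ℝ, GevreyQMC.SmoothOnCube F → GevreyQMC.GevreyBound δ CF β F →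
          GevreyQMC.rmse s (2 ^ m) z F ≤
            C ^ ((1 : ℝ) / 2) * ((2 ^ m : ℝ) / 2) ^ (-(1 / (2 * ϑ))) := by
  obtain ⟨h0, h1, hpq, hϑp⟩ := GevreyQMC.exponent_bounds hδ hpδ hϑ
  obtain ⟨S, hS, hSb⟩ :=
    GevreyQMC.exists_bound_sum_weight hδ hp hβpos hβ hcrit h0 h1 hpq hϑp
  refine ⟨CF ^ 2 * S * S ^ (1 / ϑ), by positivity, fun s m hm => ⟨?_, fun z hz F hs hF => ?_⟩⟩
  · exact GevreyQMC.exists_isCBC (by calc 2 = 2 ^ 1 := by norm_num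
      _ ≤ 2 ^ m := Nat.pow_le_pow_right two_pos hm) _ s
  · have h := hF.rmse_le_of_isCBC h0 h1 hCF hβpos hS (hSb s) hz hs
    -- The number of admissible residues is half of `n` for a power of two, hence `n / 2` in the
    -- rate.
    have ht : ((Nat.totient (2 ^ m) : ℕ) : ℝ) = (2 ^ m : ℝ) / 2 := by
      rw [Nat.totient_prime_pow Nat.prime_two hm]
      obtain ⟨k, rfl⟩ := Nat.exists_eq_add_of_le hm
      push_cast
      rw [Nat.add_sub_cancel_left, pow_add]
      ring
    rwa [ht] at h
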